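/- Let $\rho=e^{2\pi i/3}$, $\tau=\frac{1+\sqrt5}{2}$, and let $\mathcal V_{3\cdot 360}\subset \mathrm{SL}_3(\mathbb C)$ be the linear Valentiner group of order $1080$ generated by $\rho I$ and $$Z_1=\begin{pmatrix}1&0&0\\0&-1&0\\0&0&-1\end{pmatrix},\quad T_1=\begin{pmatrix}0&0&1\\1&0&0\\0&1&0\end{pmatrix},\quad P=\frac12\begin{pmatrix}1&\tau^{-1}&-\tau\\ \tau^{-1}&\tau&1\\ \tau&-1&\tau^{-1}\end{pmatrix},\quad Q=\begin{pmatrix}1&0&0\\0&0&\rho^2\\0&-\rho&0\end{pmatrix}.$$ Let $C_1(x)=x_1^2+x_2^2+x_3^2$, $C_2(x)=C_1(Q^{-1}x)$, and $C_3,C_4,C_5,C_6$ be $C_2(P^{-4}x),C_2(P^{-3}x),C_2(P^{-2}x),C_2(P^{-1}x)$. For arbitrary nonzero normalizing constants $a,b,c\in\mathbb C$ put $$F=a\sum_{m=1}^6C_m^3,\qquad \Phi=b\,\det H(F),\qquad \Psi=c\,\det\begin{pmatrix}H(\Phi)&\nabla F\\ (\nabla F)^{t}&0\end{pmatrix},$$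 where $H$ denotes the Hessian matrix and $\nabla$ the formal gradient; these polynomials are homogeneous of degrees $6,12,30$. Put $\psi_{16}=\nabla F\times\nabla\Phi$, $\phi_{34}=\nabla F\times\nabla\Psi$, $f_{40}=\nabla\Phi\times\nabla\Psi$. A polynomial $p$ on $\mathbb C^3$ is an invariant if $p(Tx)=p(x)$, and a polynomial map $f:\mathbb C^3\to\mathbb C^3$ an equivariant if $f(Tx)=Tf(x)$, for all $T\in\mathcal V_{3\cdot360}$ and $x\in\mathbb C^3$. Then: 1. The space of homogeneous invariants of degree $48$ has basis $F^8,\ F^6\Phi,\ F^4\Phi^2,\ F^2\Phi^3,\ \Phi^4,\ F^3\Psi,\ F\Phi\Psi$ (dimension $7$); that of degree $30$ has basis $F^5,\ F^3\Phi,\ F\Phi^2,\ \Psi$ (dimension $4$); and that of degree $24$ has basis $F^4,\ F^2\Phi,\ \Phi^2$ (dimension $3$). 2. The $14$ maps obtained by multiplying $\psi_{16}$ by the $7$ basis invariants of degree $48$, $\phi_{34}$ by the $4$ of degree $30$, and $f_{40}$ by the $3$ of degree $24$ are linearly independent and span the complex vector space of homogeneous degree-$64$ equivariants, which therefore has dimension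 $14$. -/

import Mathlib

open scoped Matrix

namespace Valentiner

/-- Homogeneous-coordinate polynomials in three complex variables. -/
abbrev Poly : Type := MvPolynomial (Fin 3) ℂ

noncomputable section

/-- The primitive cube root of unity `ρ = exp(2πi/3)`. -/
def rho : ℂ := Complex.exp (2 * Real.pi * Complex.I / 3)

/-- The golden ratio `τ = (1 + √5)/2`, as a complex number. -/
def tau : ℂ := (Real.goldenRatio : ℂ)

theorem rho_pow_three : rho ^ 3 = 1 := by
  rw [rho, ← Complex.exp_nat_mul]
  rw [show ((3 : ℕ) : ℂ) * (2 * Real.pi * Complex.I / 3) = 2 * Real.pi * Complex.I by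
    push_cast; ring]
  exact Complex.exp_two_pi_mul_I

theorem tau_sq : tau ^ 2 = tau + 1 := by
  rw [tau]
  exact_mod_cast Real.goldenRatio_sq

theorem tau_ne_zero : tau ≠ 0 := by
  rw [tau]
  exact_mod_cast Real.goldenRatio_ne_zero

/-- The half-turn `Z₁` of the tetrahedral group. -/
def genZ : Matrix.SpecialLinearGroup (Fin 3) ℂ :=
  ⟨!![1, 0, 0; 0, -1, 0; 0, 0, -1], by simp [Matrix.det_fin_three]⟩

/-- The order-three element `T₁` of the tetrahedral group; `Z₁` and `T₁` generate that group of
twelve rotations. -/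
def genT : Matrix.SpecialLinearGroup (Fin 3) ℂ :=
  ⟨!![0, 0, 1; 1, 0, 0; 0, 1, 0], by simp [Matrix.det_fin_three]⟩

/-- The order-five rotation `P`, which extends the tetrahedral group to an icosahedral group. -/
def genP : Matrix.SpecialLinearGroup (Fin 3) ℂ :=
  ⟨!![1 / 2, tau⁻¹ / 2, -tau / 2; tau⁻¹ / 2, tau / 2, 1 / 2; tau / 2, -1 / 2, tau⁻¹ / 2], by
    have h : tau⁻¹ = tau - 1 := by
      rw [inv_eq_iff_eq_inv, eq_comm, inv_eq_iff_eq_inv, eq_comm]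
      apply inv_eq_of_mul_eq_one_right
      linear_combination tau_sq
    simp only [Matrix.det_fin_three, Matrix.of_apply, Matrix.cons_val', Matrix.cons_val_zero,
      Matrix.cons_val_one, Matrix.cons_val, Matrix.cons_val_fin_one, h]
    linear_combination (3 / 4 : ℂ) * tau_sq⟩

/-- The order-four element `Q`, which extends the icosahedral group to the Valentiner group. -/
def genQ : Matrix.SpecialLinearGroup (Fin 3) ℂ :=
  ⟨!![1, 0, 0; 0, 0, rho ^ 2; 0, -rho, 0], by
    simp [Matrix.det_fin_three]
    linear_combination rho_pow_three⟩

/-- The scalar matrix `ρ I`. -/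
def genScalar : Matrix.SpecialLinearGroup (Fin 3) ℂ :=
  ⟨!![rho, 0, 0; 0, rho, 0; 0, 0, rho], by
    simp [Matrix.det_fin_three]
    linear_combination rho_pow_three⟩

/-- The linear Valentiner group of order `3 · 360`: the preimage in `SL₃(ℂ)` of the Valentiner
group `⟨Z₁, T₁, P, Q⟩ ⊂ PGL₃(ℂ)`.  The kernel of `SL₃(ℂ) → PGL₃(ℂ)` is generated by `ρ I`, which
is therefore listed among the generators. -/
def group : Subgroup (Matrix.SpecialLinearGroup (Fin 3) ℂ) :=
  Subgroup.closure {genZ, genT, genP, genQ, genScalar}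

/-- The polynomial `f(M x)`. -/
def subst (M : Matrix.SpecialLinearGroup (Fin 3) ℂ) (f : Poly) : Poly :=
  MvPolynomial.aeval
    (fun i => ∑ j, MvPolynomial.C ((M : Matrix (Fin 3) (Fin 3) ℂ) i j) * MvPolynomial.X j) f

/-- The icosahedral conic form `C₁(x) = x₁² + x₂² + x₃²`. -/
def conicOne : Poly :=
  MvPolynomial.X 0 ^ 2 + MvPolynomial.X 1 ^ 2 + MvPolynomial.X 2 ^ 2

/-- The conic form `C₂(x) = C₁(Q⁻¹ x)`. -/
def conicTwo : Poly := subst genQ⁻¹ conicOne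

/-- The six conic forms of one system:
`C₁`, `C₂`, `C₂(P⁻⁴ x)`, `C₂(P⁻³ x)`, `C₂(P⁻² x)`, `C₂(P⁻¹ x)`. -/
def conic : Fin 6 → Poly :=
  ![conicOne, conicTwo, subst (genP⁻¹ ^ 4) conicTwo, subst (genP⁻¹ ^ 3) conicTwo,
    subst (genP⁻¹ ^ 2) conicTwo, subst genP⁻¹ conicTwo]

/-- The formal gradient. -/
def grad (f : Poly) : Fin 3 → Poly := fun i => MvPolynomial.pderiv i f

/-- The Hessian matrix `H(f)`. -/
def hessian (f : Poly) : Matrix (Fin 3) (Fin 3) Poly :=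
  Matrix.of fun i j => MvPolynomial.pderiv i (MvPolynomial.pderiv j f)

/-- The bordered Hessian `BH(F, Φ)`: the Hessian of `Φ` bordered by the gradient of `F`. -/
def borderedHessian (F Φ : Poly) : Matrix (Fin 3 ⊕ Unit) (Fin 3 ⊕ Unit) Poly :=
  Matrix.fromBlocks (hessian Φ) (Matrix.replicateCol Unit (grad F))
    (Matrix.replicateRow Unit (grad F)) 0

/-- The homogeneous polynomials of degree `m` invariant under the linear Valentiner group. -/
def invariants (m : ℕ) : Submodule ℂ Poly where
  carrier := {f | f.IsHomogeneous m ∧ ∀ T ∈ group, ∀ x : Fin 3 → ℂ,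
    MvPolynomial.eval ((T : Matrix (Fin 3) (Fin 3) ℂ) *ᵥ x) f = MvPolynomial.eval x f}
  zero_mem' := ⟨MvPolynomial.isHomogeneous_zero _ _ _, by simp⟩
  add_mem' := by
    rintro f g ⟨hf, hf'⟩ ⟨hg, hg'⟩
    refine ⟨hf.add hg, fun T hT x => ?_⟩
    rw [map_add, map_add, hf' T hT x, hg' T hT x]
  smul_mem' := by
    rintro c f ⟨hf, hf'⟩
    refine ⟨(MvPolynomial.homogeneousSubmodule (Fin 3) ℂ m).smul_mem c hf, fun T hT x => ?_⟩
    rw [MvPolynomial.smul_eval, MvPolynomial.smul_eval, hf' T hT x]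

/-- The map `ℂ³ → ℂ³` given by three polynomials. -/
def evalMap (f : Fin 3 → Poly) (x : Fin 3 → ℂ) : Fin 3 → ℂ := fun i => MvPolynomial.eval x (f i)

/-- The degree-`m` equivariants: polynomial maps `f : ℂ³ → ℂ³`, homogeneous of degree `m`, with
`f(T x) = T f(x)` for all `T` in the linear Valentiner group. -/
def equivariants (m : ℕ) : Submodule ℂ (Fin 3 → Poly) where
  carrier := {f | (∀ i, (f i).IsHomogeneous m) ∧ ∀ T ∈ group, ∀ x : Fin 3 → ℂ,
    evalMap f ((T : Matrix (Fin 3) (Fin 3) ℂ) *ᵥ x)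
      = (T : Matrix (Fin 3) (Fin 3) ℂ) *ᵥ evalMap f x}
  zero_mem' := by
    refine ⟨fun i => MvPolynomial.isHomogeneous_zero _ _ _, fun T _ x => ?_⟩
    have h : ∀ y, evalMap 0 y = 0 := fun y => by ext i; simp [evalMap]
    rw [h, h, Matrix.mulVec_zero]
  add_mem' := by
    rintro f g ⟨hf, hf'⟩ ⟨hg, hg'⟩
    refine ⟨fun i => (hf i).add (hg i), fun T hT x => ?_⟩
    have h : ∀ y, evalMap (f + g) y = evalMap f y + evalMap g y := fun y => by
      ext i; simp [evalMap]
    rw [h, h, hf' T hT x, hg' T hT x, Matrix.mulVec_add]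
  smul_mem' := by
    rintro c f ⟨hf, hf'⟩
    refine ⟨fun i => (MvPolynomial.homogeneousSubmodule (Fin 3) ℂ m).smul_mem c (hf i),
      fun T hT x => ?_⟩
    have h : ∀ y, evalMap (c • f) y = c • evalMap f y := fun y => by
      ext i; simp [evalMap, MvPolynomial.smul_eval]
    rw [h, h, hf' T hT x, Matrix.mulVec_smul]

/-- The seven monomials of degree 48 in `F`, `Φ`, `Ψ` (of degrees 6, 12, 30). -/
def mon48 (F Φ Ψ : Poly) : Fin 7 → Poly :=
  ![F ^ 8, F ^ 6 * Φ, F ^ 4 * Φ ^ 2, F ^ 2 * Φ ^ 3, Φ ^ 4, F ^ 3 * Ψ, F * Φ * Ψ]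

/-- The four monomials of degree 30 in `F`, `Φ`, `Ψ`. -/
def mon30 (F Φ Ψ : Poly) : Fin 4 → Poly :=
  ![F ^ 5, F ^ 3 * Φ, F * Φ ^ 2, Ψ]

/-- The three monomials of degree 24 in `F`, `Φ`. -/
def mon24 (F Φ : Poly) : Fin 3 → Poly :=
  ![F ^ 4, F ^ 2 * Φ, Φ ^ 2]

/-- `ψ₁₆ = ∇F × ∇Φ`. -/
def psi16 (F Φ : Poly) : Fin 3 → Poly := crossProduct (grad F) (grad Φ)

/-- `φ₃₄ = ∇F × ∇Ψ`. -/
def phi34 (F Ψ : Poly) : Fin 3 → Poly := crossProduct (grad F) (grad Ψ)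

/-- `f₄₀ = ∇Φ × ∇Ψ`. -/
def f40 (Φ Ψ : Poly) : Fin 3 → Poly := crossProduct (grad Φ) (grad Ψ)

/-- The fourteen promotions of `ψ₁₆`, `φ₃₄`, `f₄₀` to degree 64. -/
def maps64 (F Φ Ψ : Poly) : Fin 7 ⊕ Fin 4 ⊕ Fin 3 → (Fin 3 → Poly) :=
  Sum.elim (fun k => mon48 F Φ Ψ k • psi16 F Φ)
    (Sum.elim (fun k => mon30 F Φ Ψ k • phi34 F Ψ) (fun k => mon24 F Φ k • f40 Φ Ψ))

end

end Valentiner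

/-! The matrix `genZ` has eigenvalues 1, -1, -1, so its negative is a reflection. An invariant of
odd degree changes sign under that reflection, hence vanishes on its mirror and, by invariance, on
every image of this mirror under the group. Forty-five distinct mirrors arise, so the product of
their linear forms divides every invariant of odd degree (`mirrorProd_dvd`). The Jacobian J of F, Φ,
Ψ is itself an invariant of degree 5 + 11 + 29 = 45; being nonzero, it is a constant times that
product. Thus J divides every invariant of odd degree (`dvd_of_odd`).

The rest follows from this divisibility, without averaging or Molien series. If p is an invariant of
even degree d > 0, replacing one of F, Φ, Ψ by p in J gives three invariants of odd degree, so they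
are JA, JB, JC with A, B, C invariant. Cramer's rule and Euler's identity give d p = 6AF + 12BΦ +
30CΨ, and induction on the degree makes p a polynomial in F, Φ, Ψ (`IsBasic.mem_span_monomials`). If
f is an equivariant of degree 64, its pairings with ∇Ψ, ∇Φ, ∇F are invariants of odd degree, and
they are, up to sign, the coefficients of Jf in terms of ψ₁₆, φ₃₄, f₄₀; cancelling J leaves
invariant coefficients of degrees 48, 30, 24 (`span_maps64`). Since J ≠ 0, the forms F, Φ, Ψ are
algebraically independent and the three cross products are independent over the polynomial ring;
this gives all the linear independence.

The concrete facts are checked by exact arithmetic in ℤ[τ, ρ]: the sum of cubes is a nonzero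
multiple of an explicit invariant sextic, J does not vanish at (1, 1, 2), and forty-five mirrors are
pairwise distinct. -/

namespace Valentiner

open MvPolynomial

/-! ### Linear substitutions; invariance of Hessians, Jacobians and cross products -/

/-- The substitution `f ↦ f(M x)` as an algebra homomorphism. -/
noncomputable def substHom (M : Matrix.SpecialLinearGroup (Fin 3) ℂ) : Poly →ₐ[ℂ] Poly :=
  aeval fun i => ∑ j, C ((M : Matrix (Fin 3) (Fin 3) ℂ) i j) * X j

theorem subst_eq_substHom (M : Matrix.SpecialLinearGroup (Fin 3) ℂ) (f : Poly) :
    subst M f = substHom M f := rfl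

theorem eval_substHom (M : Matrix.SpecialLinearGroup (Fin 3) ℂ) (f : Poly) (x : Fin 3 → ℂ) :
    eval x (substHom M f) = eval ((M : Matrix (Fin 3) (Fin 3) ℂ) *ᵥ x) f := by
  have h : (eval x).comp (substHom M : Poly →+* Poly) =
      eval ((M : Matrix (Fin 3) (Fin 3) ℂ) *ᵥ x) := by
    ext i
    · simp
    · simp [substHom, Matrix.mulVec, dotProduct]
  exact DFunLike.congr_fun h f

theorem substHom_substHom (M N : Matrix.SpecialLinearGroup (Fin 3) ℂ) (f : Poly) :
    substHom M (substHom N f) = substHom (N * M) f :=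
  funext fun x => by simp [eval_substHom]

theorem substHom_one (f : Poly) : substHom 1 f = f :=
  funext fun x => by simp [eval_substHom]

/-- Invariance of a polynomial under the Valentiner group. -/
def IsInvariant (f : Poly) : Prop := ∀ T ∈ group, substHom T f = f

/-- Over an infinite field a polynomial is determined by its values, so pointwise invariance is an
identity of polynomials. -/
theorem mem_invariants {m : ℕ} {f : Poly} :
    f ∈ invariants m ↔ f.IsHomogeneous m ∧ IsInvariant f := by
  refine and_congr_right fun _ => forall₂_congr fun T _ => ?_
  simp_rw [← eval_substHom]
  exact ⟨fun h => funext h, fun h x => by rw [h]⟩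

/-- Equivariance of a triple of polynomials under the Valentiner group. -/
def IsEquivariant (f : Fin 3 → Poly) : Prop :=
  ∀ T ∈ group, ∀ i, substHom T (f i) = ∑ j, C ((T : Matrix (Fin 3) (Fin 3) ℂ) i j) * f j

theorem mem_equivariants {m : ℕ} {f : Fin 3 → Poly} :
    f ∈ equivariants m ↔ (∀ i, (f i).IsHomogeneous m) ∧ IsEquivariant f := by
  refine and_congr_right fun _ => forall₂_congr fun T _ => ?_
  refine ⟨fun h i => funext fun x => ?_, fun h x => _root_.funext fun i => ?_⟩
  · rw [eval_substHom]
    simpa [evalMap, Matrix.mulVec, dotProduct] using congrFun (h x) i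
  · rw [evalMap, ← eval_substHom, h]
    simp [evalMap, Matrix.mulVec, dotProduct]

theorem isInvariant_of_generators {f : Poly} (hZ : substHom genZ f = f) (hT : substHom genT f = f)
    (hP : substHom genP f = f) (hQ : substHom genQ f = f) (hS : substHom genScalar f = f) :
    IsInvariant f := by
  intro T hT'
  induction hT' using Subgroup.closure_induction with
  | mem x hx =>
    simp only [Set.mem_insert_iff, Set.mem_singleton_iff] at hx
    rcases hx with h | h | h | h | h <;> rw [h]
    exacts [hZ, hT, hP, hQ, hS]
  | one => exact substHom_one f
  | mul x y _ _ hx hy => rw [← substHom_substHom, hx, hy]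
  | inv x _ hx =>
    calc substHom x⁻¹ f = substHom x⁻¹ (substHom x f) := by rw [hx]
      _ = f := by rw [substHom_substHom, mul_inv_cancel, substHom_one]

theorem pderiv_substHom (M : Matrix.SpecialLinearGroup (Fin 3) ℂ) (f : Poly) (i : Fin 3) :
    pderiv i (substHom M f) =
      ∑ k, C ((M : Matrix (Fin 3) (Fin 3) ℂ) k i) * substHom M (pderiv k f) := by
  induction f using MvPolynomial.induction_on with
  | C a => simp
  | add p q hp hq => simp only [map_add, hp, hq, mul_add, Finset.sum_add_distrib]
  | mul_X p n hp =>
    have h : pderiv i (substHom M (X n)) = C ((M : Matrix (Fin 3) (Fin 3) ℂ) n i) := by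
      simp [substHom, Pi.single_apply]
    have h' : ∀ k, substHom M (pderiv k (p * X n)) =
        substHom M p * (if n = k then 1 else 0) + substHom M (X n) * substHom M (pderiv k p) :=
      fun k => by
        rw [Derivation.leibniz, smul_eq_mul, smul_eq_mul, map_add, map_mul, map_mul, pderiv_X,
          Pi.single_apply, apply_ite (substHom M), map_one, map_zero]
    rw [map_mul, Derivation.leibniz, hp, h, smul_eq_mul, smul_eq_mul, Finset.mul_sum]
    simp_rw [h', mul_add, Finset.sum_add_distrib]
    refine congrArg₂ (· + ·) ?_ ?_
    · simp only [mul_ite, mul_one, mul_zero, Finset.sum_ite_eq, Finset.mem_univ, if_true]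
      exact mul_comm _ _
    · exact Finset.sum_congr rfl fun k _ => by ring

/-- The matrix of a group element with constant polynomials as entries. -/
noncomputable def constMatrix (M : Matrix.SpecialLinearGroup (Fin 3) ℂ) :
    Matrix (Fin 3) (Fin 3) Poly :=
  (C : ℂ →+* Poly).mapMatrix (M : Matrix (Fin 3) (Fin 3) ℂ)

theorem det_constMatrix (M : Matrix.SpecialLinearGroup (Fin 3) ℂ) : (constMatrix M).det = 1 := by
  rw [constMatrix, ← RingHom.map_det, M.det_coe, map_one]

theorem grad_substHom (M : Matrix.SpecialLinearGroup (Fin 3) ℂ) (f : Poly) (i : Fin 3) :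
    grad (substHom M f) i = ∑ k, constMatrix M k i * substHom M (grad f k) :=
  pderiv_substHom M f i

/-- The chain rule applied twice. As det M = 1, the Hessian determinant is a covariant with no extra
factor. -/
theorem hessian_substHom (M : Matrix.SpecialLinearGroup (Fin 3) ℂ) (f : Poly) :
    hessian (substHom M f) =
      (constMatrix M)ᵀ * (substHom M : Poly →+* Poly).mapMatrix (hessian f) * constMatrix M := by
  ext1 i j
  simp only [hessian, Matrix.of_apply, pderiv_substHom, map_sum, Derivation.leibniz, pderiv_C,
    smul_eq_mul, mul_zero, add_zero, Matrix.mul_apply, Matrix.transpose_apply, constMatrix,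
    RingHom.mapMatrix_apply, Matrix.map_apply, RingHom.coe_coe, Finset.sum_mul, Finset.mul_sum]
  exact Finset.sum_congr rfl fun k _ => Finset.sum_congr rfl fun l _ => by ring

theorem det_hessian_substHom (M : Matrix.SpecialLinearGroup (Fin 3) ℂ) (f : Poly) :
    (hessian (substHom M f)).det = substHom M (hessian f).det := by
  rw [hessian_substHom, Matrix.det_mul, Matrix.det_mul, Matrix.det_transpose, det_constMatrix,
    ← RingHom.map_det]
  simp

/-- The border transforms like a gradient, so the whole matrix changes by the congruence with M ⊕ 1,
again of determinant 1. -/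
theorem borderedHessian_substHom (M : Matrix.SpecialLinearGroup (Fin 3) ℂ) (f g : Poly) :
    borderedHessian (substHom M f) (substHom M g) =
      (Matrix.fromBlocks (constMatrix M) 0 0 1)ᵀ *
        (substHom M : Poly →+* Poly).mapMatrix (borderedHessian f g) *
        Matrix.fromBlocks (constMatrix M) 0 0 (1 : Matrix Unit Unit Poly) := by
  simp only [borderedHessian, hessian_substHom, RingHom.mapMatrix_apply]
  rw [Matrix.fromBlocks_map, Matrix.fromBlocks_transpose, Matrix.fromBlocks_multiply,
    Matrix.fromBlocks_multiply]
  congr 1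
  · simp
  · ext1 i j
    simp [grad_substHom, Matrix.mul_apply]
  · ext1 i j
    simp [grad_substHom, Matrix.mul_apply, mul_comm]
  · simp

theorem det_borderedHessian_substHom (M : Matrix.SpecialLinearGroup (Fin 3) ℂ) (f g : Poly) :
    (borderedHessian (substHom M f) (substHom M g)).det =
      substHom M (borderedHessian f g).det := by
  rw [borderedHessian_substHom, Matrix.det_mul, Matrix.det_mul, Matrix.det_transpose,
    Matrix.det_fromBlocks_zero₂₁, det_constMatrix, ← RingHom.map_det]
  simp

/-- The Jacobian determinant of three polynomials. -/
noncomputable def jac (f g h : Poly) : Poly := (Matrix.of ![grad f, grad g, grad h]).det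

theorem jac_eq (f g h : Poly) : jac f g h =
    pderiv 0 f * (pderiv 1 g * pderiv 2 h - pderiv 2 g * pderiv 1 h)
      - pderiv 1 f * (pderiv 0 g * pderiv 2 h - pderiv 2 g * pderiv 0 h)
      + pderiv 2 f * (pderiv 0 g * pderiv 1 h - pderiv 1 g * pderiv 0 h) := by
  simp [jac, Matrix.det_fin_three, grad]
  ring

theorem jac_substHom (M : Matrix.SpecialLinearGroup (Fin 3) ℂ) (f g h : Poly) :
    jac (substHom M f) (substHom M g) (substHom M h) = substHom M (jac f g h) := by
  have key : Matrix.of ![grad (substHom M f), grad (substHom M g), grad (substHom M h)] =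
      (substHom M : Poly →+* Poly).mapMatrix (Matrix.of ![grad f, grad g, grad h]) *
        constMatrix M := by
    ext1 i j
    fin_cases i <;> simp [grad_substHom, Matrix.mul_apply, mul_comm]
  rw [jac, key, Matrix.det_mul, det_constMatrix, ← RingHom.map_det, mul_one]
  rfl

theorem IsInvariant.jac {f g h : Poly} (hf : IsInvariant f) (hg : IsInvariant g)
    (hh : IsInvariant h) : IsInvariant (jac f g h) := fun T hT => by
  rw [← jac_substHom, hf T hT, hg T hT, hh T hT]

theorem IsInvariant.mul {f g : Poly} (hf : IsInvariant f) (hg : IsInvariant g) :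
    IsInvariant (f * g) := fun T hT => by rw [map_mul, hf T hT, hg T hT]

theorem IsInvariant.pow {f : Poly} (hf : IsInvariant f) (n : ℕ) :
    IsInvariant (f ^ n) := fun T hT => by rw [map_pow, hf T hT]

theorem IsInvariant.smul {f : Poly} (hf : IsInvariant f) (a : ℂ) :
    IsInvariant (a • f) := fun T hT => by rw [map_smul, hf T hT]

theorem IsInvariant.det_hessian {f : Poly} (hf : IsInvariant f) :
    IsInvariant (hessian f).det := fun T hT => by rw [← det_hessian_substHom, hf T hT]

theorem IsInvariant.det_borderedHessian {f g : Poly} (hf : IsInvariant f) (hg : IsInvariant g) :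
    IsInvariant (borderedHessian f g).det := fun T hT => by
  rw [← det_borderedHessian_substHom, hf T hT, hg T hT]

/-- If `J p` and `J` are invariant and `J ≠ 0` then `p` is invariant. -/
theorem IsInvariant.of_mul {J p : Poly} (hJ : IsInvariant J) (h0 : J ≠ 0)
    (h : IsInvariant (J * p)) : IsInvariant p := fun T hT => by
  have := h T hT
  rw [map_mul, hJ T hT] at this
  exact mul_left_cancel₀ h0 this

/-- An equivariant transforms by T and a gradient contragrediently, so their pairing is unchanged.
-/
theorem IsEquivariant.isInvariant_dotProduct {f : Fin 3 → Poly} {p : Poly} (hf : IsEquivariant f)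
    (hp : IsInvariant p) : IsInvariant (f ⬝ᵥ grad p) := fun T hT => by
  have h : ∀ i, grad p i = ∑ k, constMatrix T k i * substHom T (grad p k) := fun i => by
    rw [← grad_substHom, hp T hT]
  have h' : f ⬝ᵥ grad p = ∑ i, f i * ∑ k, constMatrix T k i * substHom T (grad p k) :=
    Finset.sum_congr rfl fun i _ => by rw [← h]
  conv_rhs => rw [h']
  simp only [dotProduct, map_sum, map_mul, hf T hT, Finset.mul_sum, Finset.sum_mul]
  rw [Finset.sum_comm]
  exact Finset.sum_congr rfl fun k _ => Finset.sum_congr rfl fun i _ => by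
    simp only [constMatrix, RingHom.mapMatrix_apply, Matrix.map_apply]; ring

/-- The cofactor identity. With determinant 1 it turns two contragredient vectors, such as gradients
of invariants, into an equivariant one. -/
theorem mulVec_crossProduct {A : Type*} [CommRing A] (M : Matrix (Fin 3) (Fin 3) A)
    (u v : Fin 3 → A) :
    M *ᵥ crossProduct (Mᵀ *ᵥ u) (Mᵀ *ᵥ v) = M.det • crossProduct u v := by
  ext i
  simp only [Matrix.mulVec, dotProduct, cross_apply, Matrix.det_fin_three, Fin.sum_univ_three,
    Matrix.transpose_apply, Pi.smul_apply, smul_eq_mul]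
  fin_cases i <;> simp <;> ring

theorem IsInvariant.isEquivariant_crossProduct {p q : Poly} (hp : IsInvariant p)
    (hq : IsInvariant q) : IsEquivariant (crossProduct (grad p) (grad q)) := fun T hT i => by
  have h : ∀ p, IsInvariant p →
      grad p = (constMatrix T)ᵀ *ᵥ fun k => substHom T (grad p k) := fun p hp => by
    ext1 i
    conv_lhs => rw [← hp T hT]
    rw [grad_substHom]
    rfl
  have key := congrFun (mulVec_crossProduct (constMatrix T) (fun k => substHom T (grad p k))
    fun k => substHom T (grad q k)) i
  rw [← h p hp, ← h q hq, det_constMatrix, one_smul] at key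
  refine Eq.trans ?_ key.symm
  rw [cross_apply, cross_apply]
  fin_cases i <;> simp

theorem IsInvariant.smul_isEquivariant {p : Poly} {f : Fin 3 → Poly} (hp : IsInvariant p)
    (hf : IsEquivariant f) : IsEquivariant (p • f) := fun T hT i => by
  simp only [Pi.smul_apply, smul_eq_mul, map_mul, hp T hT, hf T hT, Finset.mul_sum]
  exact Finset.sum_congr rfl fun k _ => by ring

/-! ### Homogeneity of quotients and determinants -/

section Homogeneous

variable {σ K : Type*} [CommRing K] [IsDomain K]

/-- The component of Jp in degree n + j is J times the component of p in degree j; for j ≠ k the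
former is zero and J cancels. -/
theorem isHomogeneous_of_mul {J p : MvPolynomial σ K} {n k : ℕ} (hJ : J.IsHomogeneous n)
    (h0 : J ≠ 0) (h : (J * p).IsHomogeneous (n + k)) : p.IsHomogeneous k := by
  have hz : ∀ j, j ≠ k → homogeneousComponent j p = 0 := fun j hj => by
    let _ := gradedAlgebra (σ := σ) (R := K)
    have h1 := DirectSum.coe_decompose_mul_add_of_left_mem (homogeneousSubmodule σ K)
      (i := n) (j := j) (b := p) ((mem_homogeneousSubmodule n J).2 hJ)
    rw [DirectSum.decompose_of_mem_ne (homogeneousSubmodule σ K)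
      ((mem_homogeneousSubmodule _ _).2 h) (by omega)] at h1
    rw [← decomposition.decompose'_apply]
    exact (mul_eq_zero.1 h1.symm).resolve_left h0
  intro d hd
  change Finsupp.weight (fun _ : σ => 1) d = k
  rw [← Finsupp.degree_eq_weight_one]
  by_contra hne
  apply hd
  have := congrArg (coeff d) (hz d.degree hne)
  rwa [coeff_homogeneousComponent, if_pos rfl, coeff_zero] at this

theorem eq_zero_of_mul_isHomogeneous {J p : MvPolynomial σ K} {n m : ℕ} (hJ : J.IsHomogeneous n)
    (h0 : J ≠ 0) (h : (J * p).IsHomogeneous m) (hm : m < n) : p = 0 := by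
  by_contra hp
  have h1 := h.totalDegree (mul_ne_zero h0 hp)
  rw [totalDegree_mul_of_isDomain h0 hp, hJ.totalDegree h0] at h1
  omega

/-- With degrees split into row and column weights, every permutation contributes a product of the
same degree. -/
theorem isHomogeneous_det {σ K : Type*} [CommRing K] {ι : Type*} [Fintype ι] [DecidableEq ι]
    {M : Matrix ι ι (MvPolynomial σ K)} {v w : ι → ℕ}
    (h : ∀ i j, (M i j).IsHomogeneous (v i + w j)) :
    M.det.IsHomogeneous (∑ i, v i + ∑ i, w i) := by
  rw [Matrix.det_apply]
  refine IsHomogeneous.sum _ _ _ fun s _ => ?_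
  have h1 : (∏ i, M (s i) i).IsHomogeneous (∑ i, v i + ∑ i, w i) := by
    rw [← Equiv.sum_comp s v, ← Finset.sum_add_distrib]
    exact IsHomogeneous.prod _ _ _ fun i _ => h (s i) i
  rcases Int.units_eq_one_or (Equiv.Perm.sign s) with hs | hs <;> rw [hs]
  · simpa using h1
  · simpa using h1.neg

end Homogeneous

theorem isHomogeneous_jac {f g h : Poly} {i j k : ℕ} (hf : f.IsHomogeneous i)
    (hg : g.IsHomogeneous j) (hh : h.IsHomogeneous k) :
    (jac f g h).IsHomogeneous (i - 1 + (j - 1) + (k - 1)) := by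
  have := isHomogeneous_det (M := Matrix.of ![grad f, grad g, grad h])
    (v := ![i - 1, j - 1, k - 1]) (w := 0) fun a b => by
      fin_cases a
      exacts [hf.pderiv, hg.pderiv, hh.pderiv]
  rw [Fin.sum_univ_three, Pi.zero_def, Finset.sum_const_zero, add_zero] at this
  exact this

theorem isHomogeneous_det_hessian {f : Poly} {n : ℕ} (hf : f.IsHomogeneous (2 * n + 2)) :
    (hessian f).det.IsHomogeneous (6 * n) := by
  have := isHomogeneous_det (M := hessian f) (v := fun _ => n) (w := fun _ => n) fun a b => by
    have h1 := (hf.pderiv (i := b)).pderiv (i := a)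
    rwa [show 2 * n + 2 - 1 - 1 = n + n by omega] at h1
  simpa [show 6 * n = 3 * n + 3 * n by omega] using this

theorem isHomogeneous_det_borderedHessian {f g : Poly} {n : ℕ} (hf : f.IsHomogeneous (n + 1))
    (hg : g.IsHomogeneous (2 * n + 2)) : (borderedHessian f g).det.IsHomogeneous (6 * n) := by
  -- Weight n on the three inner rows and columns and 0 on the border gives degrees 2n, n and, for
  -- the zero corner, 0.
  have := isHomogeneous_det (M := borderedHessian f g) (v := Sum.elim (fun _ => n) fun _ => 0)
    (w := Sum.elim (fun _ => n) fun _ => 0) fun a b => by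
      have h1 (a b) : (hessian g a b).IsHomogeneous (n + n) := by
        have h1 := (hg.pderiv (i := b)).pderiv (i := a)
        rwa [show 2 * n + 2 - 1 - 1 = n + n by omega] at h1
      have h2 (a) : (grad f a).IsHomogeneous n := hf.pderiv
      rcases a with a | a <;> rcases b with b | b
      · exact h1 a b
      · exact h2 a
      · simpa [borderedHessian] using h2 b
      · exact isHomogeneous_zero _ _ _
  simpa [show 6 * n = 3 * n + 3 * n by omega] using this

/-! ### Even invariants are polynomials in F, Φ, Ψ -/

/-- Cramer's rule for expressing ∇p through ∇f, ∇g, ∇h. -/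
theorem jac_mul_pderiv (f g h p : Poly) (i : Fin 3) : jac f g h * pderiv i p =
    jac p g h * pderiv i f + jac f p h * pderiv i g + jac f g p * pderiv i h := by
  simp only [jac_eq]
  fin_cases i <;> simp only [Fin.zero_eta, Fin.mk_one, Fin.reduceFinMk] <;> ring

/-- Euler's identity combined with Cramer's rule. -/
theorem jac_mul_smul {f g h p : Poly} {i j k d : ℕ} (hf : f.IsHomogeneous i)
    (hg : g.IsHomogeneous j) (hh : h.IsHomogeneous k) (hp : p.IsHomogeneous d) :
    jac f g h * (d • p) = jac p g h * (i • f) + jac f p h * (j • g) + jac f g p * (k • h) := by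
  rw [← hf.sum_X_mul_pderiv, ← hg.sum_X_mul_pderiv, ← hh.sum_X_mul_pderiv,
    ← hp.sum_X_mul_pderiv]
  simp only [Finset.mul_sum, ← Finset.sum_add_distrib]
  refine Finset.sum_congr rfl fun l _ => ?_
  linear_combination X l * jac_mul_pderiv f g h p l

/-- The monomials of degree `d` in three forms of degrees `6`, `12`, `30`. -/
def monomials (F Φ Ψ : Poly) (d : ℕ) : Set Poly :=
  {q | ∃ i j k : ℕ, 6 * i + 12 * j + 30 * k = d ∧ q = F ^ i * Φ ^ j * Ψ ^ k}

theorem mul_mem_span_monomials {F Φ Ψ m : Poly} {d e : ℕ} {p : Poly}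
    (hm : m ∈ monomials F Φ Ψ e) (hp : p ∈ Submodule.span ℂ (monomials F Φ Ψ d)) :
    p * m ∈ Submodule.span ℂ (monomials F Φ Ψ (d + e)) := by
  obtain ⟨i, j, k, h, rfl⟩ := hm
  induction hp using Submodule.span_induction with
  | mem x hx =>
    obtain ⟨i', j', k', h', rfl⟩ := hx
    exact Submodule.subset_span ⟨i' + i, j' + j, k' + k, by omega, by ring⟩
  | zero => simp
  | add x y _ _ hx hy => rw [add_mul]; exact add_mem hx hy
  | smul a x _ hx => rw [smul_mul_assoc]; exact Submodule.smul_mem _ _ hx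

section Chevalley

variable {F Φ Ψ : Poly}

/-- Three basic invariant forms whose Jacobian divides every invariant form of odd degree. -/
structure IsBasic (F Φ Ψ : Poly) : Prop where
  homF : F.IsHomogeneous 6
  homΦ : Φ.IsHomogeneous 12
  homΨ : Ψ.IsHomogeneous 30
  invF : IsInvariant F
  invΦ : IsInvariant Φ
  invΨ : IsInvariant Ψ
  jac_ne_zero : jac F Φ Ψ ≠ 0
  jac_dvd : ∀ {d : ℕ} {f : Poly}, Odd d → f.IsHomogeneous d → IsInvariant f → jac F Φ Ψ ∣ f

theorem IsBasic.homJ (h : IsBasic F Φ Ψ) : (jac F Φ Ψ).IsHomogeneous 45 :=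
  isHomogeneous_jac h.homF h.homΦ h.homΨ

theorem IsBasic.invJ (h : IsBasic F Φ Ψ) : IsInvariant (jac F Φ Ψ) := h.invF.jac h.invΦ h.invΨ

/-- Every invariant form of even degree is a polynomial in the basic invariants. -/
theorem IsBasic.mem_span_monomials (h : IsBasic F Φ Ψ) (d : ℕ) : ∀ {p : Poly}, Even d →
    p.IsHomogeneous d → IsInvariant p → p ∈ Submodule.span ℂ (monomials F Φ Ψ d) := by
  induction d using Nat.strong_induction_on with
  | _ d ih =>
  intro p hd hp hinv
  rcases Nat.eq_zero_or_pos d with rfl | hpos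
  · rw [← totalDegree_zero_iff_isHomogeneous, totalDegree_eq_zero_iff_eq_C] at hp
    rw [hp, ← mul_one (C _), ← smul_eq_C_mul]
    exact Submodule.smul_mem _ _ (Submodule.subset_span ⟨0, 0, 0, by simp, by simp⟩)
  -- To be used with m one of F, Φ, Ψ, of degree e, and g the Jacobian with m replaced by p. Its
  -- degree d + 45 - e is odd, so J divides it, and the quotient has degree d - e, to which
  -- induction applies.
  have quot : ∀ (e : ℕ) (m g : Poly), 0 < e ∧ e ≤ 30 → Even e → m ∈ monomials F Φ Ψ e →
      g.IsHomogeneous (d + 45 - e) → IsInvariant g →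
      ∃ a, g = jac F Φ Ψ * a ∧ a * m ∈ Submodule.span ℂ (monomials F Φ Ψ d) := by
    intro e m g ⟨he, hle⟩ hev hm hg hginv
    obtain ⟨a, rfl⟩ := h.jac_dvd (by
      rw [Nat.odd_iff]; rw [Nat.even_iff] at hd hev; omega) hg hginv
    refine ⟨a, rfl, ?_⟩
    rcases le_or_gt e d with hed | hed
    · have ha : a.IsHomogeneous (d - e) :=
        isHomogeneous_of_mul h.homJ h.jac_ne_zero
          (by rwa [show 45 + (d - e) = d + 45 - e by omega])
      have := mul_mem_span_monomials hm
        (ih (d - e) (by omega) (by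
          rw [Nat.even_iff] at hd hev ⊢; omega) ha (h.invJ.of_mul h.jac_ne_zero hginv))
      rwa [Nat.sub_add_cancel hed] at this
    -- For e > d the degree of g is below 45, so the quotient is zero.
    · rw [eq_zero_of_mul_isHomogeneous h.homJ h.jac_ne_zero hg (by omega), zero_mul]
      exact zero_mem _
  obtain ⟨a, ha, ha'⟩ := quot 6 F (jac p Φ Ψ) (by omega) (by decide) ⟨1, 0, 0, by simp, by simp⟩
    (by
      have := isHomogeneous_jac hp h.homΦ h.homΨ
      rwa [show d - 1 + (12 - 1) + (30 - 1) = d + 45 - 6 by omega] at this)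
    (hinv.jac h.invΦ h.invΨ)
  obtain ⟨b, hb, hb'⟩ := quot 12 Φ (jac F p Ψ) (by omega) (by decide) ⟨0, 1, 0, by simp, by simp⟩
    (by
      have := isHomogeneous_jac h.homF hp h.homΨ
      rwa [show 6 - 1 + (d - 1) + (30 - 1) = d + 45 - 12 by omega] at this)
    (h.invF.jac hinv h.invΨ)
  obtain ⟨c, hc, hc'⟩ := quot 30 Ψ (jac F Φ p) (by omega) (by decide) ⟨0, 0, 1, by simp, by simp⟩
    (by
      have := isHomogeneous_jac h.homF h.homΦ hp
      rwa [show 6 - 1 + (12 - 1) + (d - 1) = d + 45 - 30 by omega] at this)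
    (h.invF.jac h.invΦ hinv)
  have key := jac_mul_smul h.homF h.homΦ h.homΨ hp
  have key' : d • p = 6 • (a * F) + 12 • (b * Φ) + 30 • (c * Ψ) := by
    apply mul_left_cancel₀ h.jac_ne_zero
    rw [key, ha, hb, hc]
    simp only [nsmul_eq_mul]
    ring
  have hmem : d • p ∈ Submodule.span ℂ (monomials F Φ Ψ d) := by
    rw [key']
    exact add_mem (add_mem (nsmul_mem ha' 6) (nsmul_mem hb' 12)) (nsmul_mem hc' 30)
  rw [← Nat.cast_smul_eq_nsmul ℂ] at hmem
  exact (Submodule.smul_mem_iff _ (Nat.cast_ne_zero.2 hpos.ne')).1 hmem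

end Chevalley

/-! ### The Jacobian criterion for algebraic independence -/

section JacobianCriterion

theorem pderiv_aeval (g : Fin 3 → Poly) (P : MvPolynomial (Fin 3) ℂ) (i : Fin 3) :
    pderiv i (aeval g P) = ∑ k, aeval g (pderiv k P) * pderiv i (g k) := by
  induction P using MvPolynomial.induction_on with
  | C a => simp
  | add p q hp hq => simp only [map_add, hp, hq, add_mul, Finset.sum_add_distrib]
  | mul_X p n hp =>
    have h : ∀ k, aeval g (pderiv k (p * X n)) =
        aeval g p * (if n = k then 1 else 0) + g n * aeval g (pderiv k p) := fun k => by
      rw [Derivation.leibniz, smul_eq_mul, smul_eq_mul, map_add, map_mul, map_mul, pderiv_X,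
        Pi.single_apply, apply_ite (aeval g), map_one, map_zero, aeval_X]
    rw [map_mul, aeval_X, Derivation.leibniz, hp, smul_eq_mul, smul_eq_mul, Finset.mul_sum]
    simp_rw [h, add_mul, Finset.sum_add_distrib]
    refine congrArg₂ (· + ·) ?_ ?_
    · simp only [mul_ite, mul_one, mul_zero, ite_mul, zero_mul, Finset.sum_ite_eq,
        Finset.mem_univ, if_true]
    · exact Finset.sum_congr rfl fun k _ => by ring

/-- Differentiating a relation P(f, g, h) = 0 gives a linear system for the values of the partials
of P, with determinant the Jacobian. So the partials of P are again relations, of lower degree, and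
vanish by induction; in characteristic zero P is then constant. -/
theorem aeval_injective_of_jac_ne_zero {f g h : Poly} (hJ : jac f g h ≠ 0) :
    Function.Injective (aeval ![f, g, h] : MvPolynomial (Fin 3) ℂ →ₐ[ℂ] Poly) := by
  rw [injective_iff_map_eq_zero]
  suffices H : ∀ (n : ℕ) (P : MvPolynomial (Fin 3) ℂ), P.totalDegree ≤ n →
      aeval ![f, g, h] P = 0 → P = 0 from fun P => H _ P le_rfl
  intro n
  induction n with
  | zero =>
    intro P hP h0
    rw [Nat.le_zero, totalDegree_eq_zero_iff_eq_C] at hP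
    rw [hP] at h0 ⊢
    rw [aeval_C, algebraMap_eq, C_eq_zero] at h0
    rw [h0, C_0]
  | succ n ih =>
    intro P hP h0
    have hd : ∀ i, ∑ k, aeval ![f, g, h] (pderiv k P) * pderiv i (![f, g, h] k) = 0 := fun i => by
      rw [← pderiv_aeval, h0, map_zero]
    simp only [Fin.sum_univ_three, Matrix.cons_val_zero, Matrix.cons_val_one, Matrix.cons_val]
      at hd
    have hk : ∀ k, aeval ![f, g, h] (pderiv k P) = 0 := by
      intro k
      refine (mul_eq_zero.1 (?_ : jac f g h * _ = 0)).resolve_left hJ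
      have h0 := hd 0
      have h1 := hd 1
      have h2 := hd 2
      rw [jac_eq]
      set A := aeval ![f, g, h] (pderiv 0 P)
      set B := aeval ![f, g, h] (pderiv 1 P)
      set D := aeval ![f, g, h] (pderiv 2 P)
      fin_cases k
      · change _ * A = 0
        linear_combination (pderiv 1 g * pderiv 2 h - pderiv 2 g * pderiv 1 h) * h0
          - (pderiv 0 g * pderiv 2 h - pderiv 2 g * pderiv 0 h) * h1
          + (pderiv 0 g * pderiv 1 h - pderiv 1 g * pderiv 0 h) * h2
      · change _ * B = 0
        linear_combination -(pderiv 1 f * pderiv 2 h - pderiv 2 f * pderiv 1 h) * h0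
          + (pderiv 0 f * pderiv 2 h - pderiv 2 f * pderiv 0 h) * h1
          - (pderiv 0 f * pderiv 1 h - pderiv 1 f * pderiv 0 h) * h2
      · change _ * D = 0
        linear_combination (pderiv 1 f * pderiv 2 g - pderiv 2 f * pderiv 1 g) * h0
          - (pderiv 0 f * pderiv 2 g - pderiv 2 f * pderiv 0 g) * h1
          + (pderiv 0 f * pderiv 1 g - pderiv 1 f * pderiv 0 g) * h2
    have hz : ∀ k, pderiv k P = 0 := by
      intro k
      refine ih _ ?_ (hk k)
      refine Finset.sup_le fun m hm => ?_
      rw [mem_support_iff, coeff_pderiv] at hm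
      have h3 := le_totalDegree (mem_support_iff.2 (left_ne_zero_of_mul hm))
      rw [Finsupp.sum_add_index' (fun _ => rfl) (fun _ _ _ => rfl),
        Finsupp.sum_single_index rfl] at h3
      omega
    -- With all partials zero, P has total degree 0, so the induction hypothesis applies to P
    -- itself.
    refine ih P (Finset.sup_le fun m hm => ?_) h0
    rcases eq_or_ne m 0 with rfl | hm0
    · simp
    · obtain ⟨k, hk⟩ := Finsupp.ne_iff.1 hm0
      rw [Finsupp.zero_apply] at hk
      have h3 := coeff_pderiv (i := k) P (m - Finsupp.single k 1)
      rw [hz, coeff_zero, tsub_add_cancel_of_le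
        (Finsupp.single_le_iff.2 (Nat.one_le_iff_ne_zero.2 hk))] at h3
      refine absurd ((mul_eq_zero.1 h3.symm).resolve_right ?_) (mem_support_iff.1 hm)
      exact Nat.cast_add_one_ne_zero _

theorem linearIndependent_monomials {f g h : Poly} (hJ : jac f g h ≠ 0) {ι : Type*}
    {e : ι → Fin 3 → ℕ} (he : Function.Injective e) :
    LinearIndependent ℂ fun i => f ^ e i 0 * g ^ e i 1 * h ^ e i 2 := by
  have h1 := ((basisMonomials (Fin 3) ℂ).linearIndependent.comp
    (fun i => Finsupp.equivFunOnFinite.symm (e i)) (Finsupp.equivFunOnFinite.symm.injective.comp he))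
  have h2 := h1.map' (aeval ![f, g, h] : MvPolynomial (Fin 3) ℂ →ₐ[ℂ] Poly).toLinearMap
    (LinearMap.ker_eq_bot.2 (aeval_injective_of_jac_ne_zero hJ))
  have h3 : (fun i => f ^ e i 0 * g ^ e i 1 * h ^ e i 2) =
      fun i => aeval ![f, g, h] (basisMonomials (Fin 3) ℂ (Finsupp.equivFunOnFinite.symm (e i))) := by
    ext1 i
    rw [coe_basisMonomials, aeval_monomial, map_one, one_mul, Finsupp.prod_fintype _ _ (by simp),
      Fin.prod_univ_three]
    rfl
  rw [h3]
  exact h2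

end JacobianCriterion

/-! ### Bases of the invariants of degrees 48, 30 and 24 -/

theorem monomials_subset_invariants {F Φ Ψ : Poly} (h : IsBasic F Φ Ψ) (d : ℕ) :
    monomials F Φ Ψ d ⊆ invariants d := by
  rintro _ ⟨i, j, k, hd, rfl⟩
  refine mem_invariants.2 ⟨?_, ((h.invF.pow i).mul (h.invΦ.pow j)).mul (h.invΨ.pow k)⟩
  rw [← hd]
  exact ((h.homF.pow i).mul (h.homΦ.pow j)).mul (h.homΨ.pow k)

theorem span_monomials_eq_invariants {F Φ Ψ : Poly} (h : IsBasic F Φ Ψ) {d : ℕ} (hd : Even d) :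
    Submodule.span ℂ (monomials F Φ Ψ d) = invariants d :=
  le_antisymm (Submodule.span_le.2 (monomials_subset_invariants h d)) fun _ hf =>
    h.mem_span_monomials d hd (mem_invariants.1 hf).1 (mem_invariants.1 hf).2

theorem monomials_48 (F Φ Ψ : Poly) : monomials F Φ Ψ 48 = Set.range (mon48 F Φ Ψ) := by
  apply Set.Subset.antisymm
  · rintro _ ⟨i, j, k, h, rfl⟩
    have hk : k ≤ 1 := by omega
    have hj : j ≤ 4 := by omega
    interval_cases k <;> interval_cases j <;> try omega
    · obtain rfl : i = 8 := by omega
      exact ⟨0, by simp [mon48]⟩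
    · obtain rfl : i = 6 := by omega
      exact ⟨1, by simp [mon48]⟩
    · obtain rfl : i = 4 := by omega
      exact ⟨2, by simp [mon48]⟩
    · obtain rfl : i = 2 := by omega
      exact ⟨3, by simp [mon48]⟩
    · obtain rfl : i = 0 := by omega
      exact ⟨4, by simp [mon48]⟩
    · obtain rfl : i = 3 := by omega
      exact ⟨5, by simp [mon48]⟩
    · obtain rfl : i = 1 := by omega
      exact ⟨6, by simp [mon48]⟩
  · rintro _ ⟨k, rfl⟩
    fin_cases k
    exacts [⟨8, 0, 0, rfl, by simp [mon48]⟩, ⟨6, 1, 0, rfl, by simp [mon48]⟩,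
      ⟨4, 2, 0, rfl, by simp [mon48]⟩, ⟨2, 3, 0, rfl, by simp [mon48]⟩,
      ⟨0, 4, 0, rfl, by simp [mon48]⟩, ⟨3, 0, 1, rfl, by simp [mon48]⟩,
      ⟨1, 1, 1, rfl, by simp [mon48]⟩]

theorem monomials_30 (F Φ Ψ : Poly) : monomials F Φ Ψ 30 = Set.range (mon30 F Φ Ψ) := by
  apply Set.Subset.antisymm
  · rintro _ ⟨i, j, k, h, rfl⟩
    have hk : k ≤ 1 := by omega
    have hj : j ≤ 2 := by omega
    interval_cases k <;> interval_cases j <;> try omega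
    · obtain rfl : i = 5 := by omega
      exact ⟨0, by simp [mon30]⟩
    · obtain rfl : i = 3 := by omega
      exact ⟨1, by simp [mon30]⟩
    · obtain rfl : i = 1 := by omega
      exact ⟨2, by simp [mon30]⟩
    · obtain rfl : i = 0 := by omega
      exact ⟨3, by simp [mon30]⟩
  · rintro _ ⟨k, rfl⟩
    fin_cases k
    exacts [⟨5, 0, 0, rfl, by simp [mon30]⟩, ⟨3, 1, 0, rfl, by simp [mon30]⟩,
      ⟨1, 2, 0, rfl, by simp [mon30]⟩, ⟨0, 0, 1, rfl, by simp [mon30]⟩]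

theorem monomials_24 (F Φ Ψ : Poly) : monomials F Φ Ψ 24 = Set.range (mon24 F Φ) := by
  apply Set.Subset.antisymm
  · rintro _ ⟨i, j, k, h, rfl⟩
    obtain rfl : k = 0 := by omega
    have hj : j ≤ 2 := by omega
    interval_cases j
    · obtain rfl : i = 4 := by omega
      exact ⟨0, by simp [mon24]⟩
    · obtain rfl : i = 2 := by omega
      exact ⟨1, by simp [mon24]⟩
    · obtain rfl : i = 0 := by omega
      exact ⟨2, by simp [mon24]⟩
  · rintro _ ⟨k, rfl⟩
    fin_cases k
    exacts [⟨4, 0, 0, rfl, by simp [mon24]⟩, ⟨2, 1, 0, rfl, by simp [mon24]⟩,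
      ⟨0, 2, 0, rfl, by simp [mon24]⟩]

theorem linearIndependent_mon48 {F Φ Ψ : Poly} (hJ : jac F Φ Ψ ≠ 0) :
    LinearIndependent ℂ (mon48 F Φ Ψ) := by
  convert linearIndependent_monomials hJ (e := ![![8, 0, 0], ![6, 1, 0], ![4, 2, 0], ![2, 3, 0],
    ![0, 4, 0], ![3, 0, 1], ![1, 1, 1]]) (by decide) using 1
  ext1 k
  fin_cases k <;> simp [mon48]

theorem linearIndependent_mon30 {F Φ Ψ : Poly} (hJ : jac F Φ Ψ ≠ 0) :
    LinearIndependent ℂ (mon30 F Φ Ψ) := by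
  convert linearIndependent_monomials hJ (e := ![![5, 0, 0], ![3, 1, 0], ![1, 2, 0], ![0, 0, 1]])
    (by decide) using 1
  ext1 k
  fin_cases k <;> simp [mon30]

theorem linearIndependent_mon24 {F Φ Ψ : Poly} (hJ : jac F Φ Ψ ≠ 0) :
    LinearIndependent ℂ (mon24 F Φ) := by
  convert linearIndependent_monomials hJ (e := ![![4, 0, 0], ![2, 1, 0], ![0, 2, 0]])
    (by decide) using 1
  ext1 k
  fin_cases k <;> simp [mon24]

/-! ### Equivariants of degree 64 -/

theorem cross_grad_apply (f g : Poly) (i : Fin 3) : crossProduct (grad f) (grad g) i =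
    ![pderiv 1 f * pderiv 2 g - pderiv 2 f * pderiv 1 g,
      pderiv 2 f * pderiv 0 g - pderiv 0 f * pderiv 2 g,
      pderiv 0 f * pderiv 1 g - pderiv 1 f * pderiv 0 g] i := by
  rw [cross_apply]; rfl

theorem isHomogeneous_crossProduct {f g : Poly} {m n : ℕ} (hf : f.IsHomogeneous m)
    (hg : g.IsHomogeneous n) (i : Fin 3) :
    (crossProduct (grad f) (grad g) i).IsHomogeneous (m - 1 + (n - 1)) := by
  rw [cross_grad_apply]
  fin_cases i <;> exact (hf.pderiv.mul hg.pderiv).sub (hf.pderiv.mul hg.pderiv)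

/-- Up to sign and the factor J, the three cross products form the basis dual to ∇Ψ, ∇Φ, ∇F. -/
theorem jac_mul_apply (F Φ Ψ : Poly) (f : Fin 3 → Poly) (i : Fin 3) : jac F Φ Ψ * f i =
    (f ⬝ᵥ grad Ψ) * psi16 F Φ i - (f ⬝ᵥ grad Φ) * phi34 F Ψ i + (f ⬝ᵥ grad F) * f40 Φ Ψ i := by
  rw [psi16, phi34, f40, cross_grad_apply, cross_grad_apply, cross_grad_apply, jac_eq]
  simp only [dotProduct, Fin.sum_univ_three, grad]
  fin_cases i <;> simp <;> ring

theorem smul_mem_of_mem_span {ι : Type*} {m : ι → Poly} {p : Poly} {v : Fin 3 → Poly}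
    {S : Submodule ℂ (Fin 3 → Poly)} (hp : p ∈ Submodule.span ℂ (Set.range m))
    (h : ∀ k, m k • v ∈ S) : p • v ∈ S := by
  induction hp using Submodule.span_induction with
  | mem x hx => obtain ⟨k, rfl⟩ := hx; exact h k
  | zero => rw [zero_smul]; exact zero_mem _
  | add x y _ _ hx hy => rw [add_smul]; exact add_mem hx hy
  | smul a x _ hx => rw [smul_assoc]; exact S.smul_mem _ hx

theorem smul_mem_equivariants {m n : ℕ} {p : Poly} {v : Fin 3 → Poly} (hp : p ∈ invariants m)
    (hv : ∀ i, (v i).IsHomogeneous n) (hv' : IsEquivariant v) : p • v ∈ equivariants (m + n) := by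
  rw [mem_invariants] at hp
  exact mem_equivariants.2 ⟨fun i => hp.1.mul (hv i), hp.2.smul_isEquivariant hv'⟩

theorem maps64_mem_equivariants {F Φ Ψ : Poly} (h : IsBasic F Φ Ψ) (k : Fin 7 ⊕ Fin 4 ⊕ Fin 3) :
    maps64 F Φ Ψ k ∈ equivariants 64 := by
  rcases k with k | k | k
  · refine smul_mem_equivariants (m := 48) (monomials_subset_invariants h 48 ?_)
      (isHomogeneous_crossProduct h.homF h.homΦ) (h.invF.isEquivariant_crossProduct h.invΦ)
    rw [monomials_48]; exact ⟨k, rfl⟩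
  · refine smul_mem_equivariants (m := 30) (monomials_subset_invariants h 30 ?_)
      (isHomogeneous_crossProduct h.homF h.homΨ) (h.invF.isEquivariant_crossProduct h.invΨ)
    rw [monomials_30]; exact ⟨k, rfl⟩
  · refine smul_mem_equivariants (m := 24) (monomials_subset_invariants h 24 ?_)
      (isHomogeneous_crossProduct h.homΦ h.homΨ) (h.invΦ.isEquivariant_crossProduct h.invΨ)
    rw [monomials_24]; exact ⟨k, rfl⟩

theorem exists_dotProduct_grad {F Φ Ψ : Poly} (h : IsBasic F Φ Ψ) {m n : ℕ} (hm : Even m)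
    {f : Fin 3 → Poly} (hf : f ∈ equivariants 64) {p : Poly} (hp : p.IsHomogeneous n)
    (hinv : IsInvariant p) (hn : 64 + (n - 1) = 45 + m) :
    ∃ q ∈ invariants m, f ⬝ᵥ grad p = jac F Φ Ψ * q := by
  rw [mem_equivariants] at hf
  have h1 : (f ⬝ᵥ grad p).IsHomogeneous (45 + m) := by
    rw [← hn]
    exact IsHomogeneous.sum _ _ _ fun i _ => (hf.1 i).mul hp.pderiv
  have h2 := hf.2.isInvariant_dotProduct hinv
  obtain ⟨q, hq⟩ := h.jac_dvd (by rw [Nat.odd_iff]; rw [Nat.even_iff] at hm; omega) h1 h2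
  rw [hq] at h1 h2
  exact ⟨q, mem_invariants.2 ⟨isHomogeneous_of_mul h.homJ h.jac_ne_zero h1,
    h.invJ.of_mul h.jac_ne_zero h2⟩, hq⟩

theorem span_maps64 {F Φ Ψ : Poly} (h : IsBasic F Φ Ψ) :
    Submodule.span ℂ (Set.range (maps64 F Φ Ψ)) = equivariants 64 := by
  apply le_antisymm
  · rw [Submodule.span_le]
    rintro _ ⟨k, rfl⟩
    exact maps64_mem_equivariants h k
  · intro f hf
    -- The degrees match: 64 + 29 = 45 + 48, 64 + 11 = 45 + 30, 64 + 5 = 45 + 24.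
    obtain ⟨p, hp, hp'⟩ := exists_dotProduct_grad h (m := 48) (by decide) hf h.homΨ h.invΨ rfl
    obtain ⟨q, hq, hq'⟩ := exists_dotProduct_grad h (m := 30) (by decide) hf h.homΦ h.invΦ rfl
    obtain ⟨r, hr, hr'⟩ := exists_dotProduct_grad h (m := 24) (by decide) hf h.homF h.invF rfl
    rw [← span_monomials_eq_invariants h (by decide), monomials_48] at hp
    rw [← span_monomials_eq_invariants h (by decide), monomials_30] at hq
    rw [← span_monomials_eq_invariants h (by decide), monomials_24] at hr
    have key : f = p • psi16 F Φ - q • phi34 F Ψ + r • f40 Φ Ψ := by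
      ext1 i
      apply mul_left_cancel₀ h.jac_ne_zero
      rw [jac_mul_apply, hp', hq', hr']
      simp only [Pi.add_apply, Pi.sub_apply, Pi.smul_apply, smul_eq_mul]
      ring
    rw [key]
    exact add_mem (sub_mem
      (smul_mem_of_mem_span hp fun k => Submodule.subset_span ⟨.inl k, rfl⟩)
      (smul_mem_of_mem_span hq fun k => Submodule.subset_span ⟨.inr (.inl k), rfl⟩))
      (smul_mem_of_mem_span hr fun k => Submodule.subset_span ⟨.inr (.inr k), rfl⟩)

theorem linearIndependent_maps64 {F Φ Ψ : Poly} (hJ : jac F Φ Ψ ≠ 0) :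
    LinearIndependent ℂ (maps64 F Φ Ψ) := by
  rw [Fintype.linearIndependent_iff]
  intro c hc
  set p := ∑ k, c (.inl k) • mon48 F Φ Ψ k with hp
  set q := ∑ k, c (.inr (.inl k)) • mon30 F Φ Ψ k with hq
  set r := ∑ k, c (.inr (.inr k)) • mon24 F Φ k with hr
  have hsum : ∀ i, p * psi16 F Φ i + (q * phi34 F Ψ i + r * f40 Φ Ψ i) = 0 := fun i => by
    have h1 := congrFun hc i
    rw [Fintype.sum_sum_type, Fintype.sum_sum_type] at h1
    simpa [maps64, hp, hq, hr, Finset.sum_mul, Finset.sum_apply] using h1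
  have h0 := hsum 0
  have h1 := hsum 1
  have h2 := hsum 2
  simp only [psi16, phi34, f40, cross_grad_apply, Matrix.cons_val_zero, Matrix.cons_val_one,
    Matrix.cons_val] at h0 h1 h2
  -- Pairing with ∇Ψ kills φ₃₄ and f₄₀ and sends ψ₁₆ to J. Below, ∇Φ isolates φ₃₄ (with a sign) and
  -- ∇F isolates f₄₀.
  have hp0 : p = 0 := by
    refine (mul_eq_zero.1 (?_ : jac F Φ Ψ * p = 0)).resolve_left hJ
    rw [jac_eq]
    linear_combination pderiv 0 Ψ * h0 + pderiv 1 Ψ * h1 + pderiv 2 Ψ * h2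
  have hq0 : q = 0 := by
    refine (mul_eq_zero.1 (?_ : jac F Φ Ψ * q = 0)).resolve_left hJ
    rw [jac_eq]
    linear_combination -pderiv 0 Φ * h0 - pderiv 1 Φ * h1 - pderiv 2 Φ * h2
  have hr0 : r = 0 := by
    refine (mul_eq_zero.1 (?_ : jac F Φ Ψ * r = 0)).resolve_left hJ
    rw [jac_eq]
    linear_combination pderiv 0 F * h0 + pderiv 1 F * h1 + pderiv 2 F * h2
  rintro (k | k | k)
  · exact Fintype.linearIndependent_iff.1 (linearIndependent_mon48 hJ) _ hp0 k
  · exact Fintype.linearIndependent_iff.1 (linearIndependent_mon30 hJ) _ hq0 k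
  · exact Fintype.linearIndependent_iff.1 (linearIndependent_mon24 hJ) _ hr0 k

/-! ### Exact arithmetic in ℤ[τ, ρ] -/

/-- The ring `ℤ[τ, ρ]`, with computable arithmetic. -/
abbrev Coef : Type := QuadraticAlgebra (QuadraticAlgebra ℤ 1 1) (-1) (-1)

/-- The element `a + b τ + c ρ + d τ ρ` of `ℤ[τ, ρ]`. -/
def coef (a b c d : ℤ) : Coef := ⟨⟨a, b⟩, ⟨c, d⟩⟩

theorem rho_eq : rho = ⟨-1 / 2, √3 / 2⟩ := by
  have h : rho = Complex.exp (((2 * Real.pi / 3 : ℝ) : ℂ) * Complex.I) := by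
    rw [rho]; congr 1; push_cast; ring
  have h1 : 2 * Real.pi / 3 = Real.pi - Real.pi / 3 := by ring
  rw [h, Complex.exp_mul_I, ← Complex.ofReal_cos, ← Complex.ofReal_sin, h1, Real.cos_pi_sub,
    Real.sin_pi_sub, Real.cos_pi_div_three, Real.sin_pi_div_three]
  apply Complex.ext
  · simp; ring
  · simp

theorem rho_sq : rho ^ 2 + rho + 1 = 0 := by
  have h : (rho - 1) * (rho ^ 2 + rho + 1) = 0 := by linear_combination rho_pow_three
  refine (mul_eq_zero.1 h).resolve_left fun h1 => ?_
  have := congrArg Complex.re h1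
  rw [rho_eq] at this
  norm_num at this

/-- The embedding of `ℤ[τ, ρ]` in `ℂ`. -/
noncomputable def coefHom : Coef →+* ℂ where
  toFun z := (z.re.re + z.re.im * tau) + (z.im.re + z.im.im * tau) * rho
  map_one' := by
    simp [QuadraticAlgebra.re_one, QuadraticAlgebra.im_one]
  map_zero' := by simp
  map_add' z w := by simp; ring
  map_mul' z w := by
    simp
    linear_combination -(z.im.re + z.im.im * tau) * (w.im.re + w.im.im * tau) * rho_sq
      - (z.re.im * w.re.im - z.im.im * w.im.im + (z.re.im * w.im.im + z.im.im * w.re.im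
        - z.im.im * w.im.im) * rho) * tau_sq

theorem coefHom_apply (z : Coef) :
    coefHom z = (z.re.re + z.re.im * tau) + (z.im.re + z.im.im * tau) * rho := rfl

theorem int_add_mul_goldenRatio_eq_zero {a b : ℤ} (h : (a : ℝ) + b * Real.goldenRatio = 0) :
    a = 0 ∧ b = 0 := by
  by_cases hb : b = 0
  · subst hb
    simpa using h
  · refine absurd ⟨-a / b, ?_⟩ Real.goldenRatio_irrational
    have : (b : ℝ) ≠ 0 := by exact_mod_cast hb
    push_cast
    rw [div_eq_iff this]
    linarith

/-- The imaginary part isolates the coefficient of ρ, then the real part the other one; each lies in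
ℤ[τ] and is settled by the irrationality of τ. -/
theorem coefHom_injective : Function.Injective coefHom := by
  rw [injective_iff_map_eq_zero]
  intro z hz
  rw [coefHom_apply, tau, rho_eq] at hz
  have him := congrArg Complex.im hz
  have hre := congrArg Complex.re hz
  simp at him hre
  rw [him] at hre
  obtain ⟨h1, h2⟩ := int_add_mul_goldenRatio_eq_zero him
  obtain ⟨h3, h4⟩ := int_add_mul_goldenRatio_eq_zero (by simpa using hre)
  ext <;> assumption

/-! ### Computable sparse polynomials -/

/-- Polynomials in three variables as lists of exponents and coefficients. -/
abbrev SparsePoly (K : Type*) : Type _ := List ((ℕ × ℕ × ℕ) × K)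

/-- The determinant of a `3 × 3` matrix. -/
def detThree {A : Type*} [CommRing A] (a b c d e f g h i : A) : A :=
  a * (e * i - f * h) + b * (f * g - d * i) + c * (d * h - e * g)

/-- The determinant of the symmetric matrix with rows `a b c`, `b d e`, `c e f`, bordered by
the vector `u v w`. -/
def detBordered {A : Type*} [CommRing A] (a b c d e f u v w : A) : A :=
  (e * e - d * f) * (u * u) + (c * c - a * f) * (v * v) + (b * b - a * d) * (w * w) +
    2 * ((b * f - c * e) * (u * v) + (c * d - b * e) * (u * w) + (a * e - b * c) * (v * w))

namespace SparsePoly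

variable {K : Type*} [CommRing K]

/-- The polynomial of one term. -/
noncomputable def term (a : (ℕ × ℕ × ℕ) × K) : MvPolynomial (Fin 3) K :=
  C a.2 * (X 0 ^ a.1.1 * X 1 ^ a.1.2.1 * X 2 ^ a.1.2.2)

/-- The polynomial represented by a list of terms. -/
noncomputable def toMv (l : SparsePoly K) : MvPolynomial (Fin 3) K := (l.map term).sum

@[simp] theorem toMv_nil : toMv ([] : SparsePoly K) = 0 := rfl

@[simp] theorem toMv_cons (a : (ℕ × ℕ × ℕ) × K) (l : SparsePoly K) :
    toMv (a :: l) = term a + toMv l := by simp [toMv]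

/-- Lexicographic comparison of exponents. -/
def keyLt (a b : ℕ × ℕ × ℕ) : Bool :=
  Nat.blt a.1 b.1 || (Nat.beq a.1 b.1 &&
    (Nat.blt a.2.1 b.2.1 || (Nat.beq a.2.1 b.2.1 && Nat.blt a.2.2 b.2.2)))

/-- Equality of exponents. -/
def keyEq (a b : ℕ × ℕ × ℕ) : Bool :=
  Nat.beq a.1 b.1 && Nat.beq a.2.1 b.2.1 && Nat.beq a.2.2 b.2.2

theorem eq_of_keyEq {a b : ℕ × ℕ × ℕ} (h : keyEq a b = true) : a = b := by
  simp only [keyEq, Bool.and_eq_true] at h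
  exact Prod.ext (Nat.eq_of_beq_eq_true h.1.1)
    (Prod.ext (Nat.eq_of_beq_eq_true h.1.2) (Nat.eq_of_beq_eq_true h.2))

/-- One step of merging two sorted lists of terms. -/
def addAux [DecidableEq K] (a : (ℕ × ℕ × ℕ) × K) (k : SparsePoly K → SparsePoly K) :
    SparsePoly K → SparsePoly K
  | [] => a :: k []
  | b :: bs => bif keyLt a.1 b.1 then a :: k (b :: bs) else
      bif keyEq a.1 b.1 then (if a.2 + b.2 = 0 then k bs else (a.1, a.2 + b.2) :: k bs)
      else b :: addAux a k bs

/-- The sum, by merging. -/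
def add [DecidableEq K] (l m : SparsePoly K) : SparsePoly K := l.foldr addAux id m

/-- The continuation `k` stands for merging the rest of the first list. Correctness does not require
sorted lists; order only makes like terms meet. -/
theorem toMv_addAux [DecidableEq K] (a : (ℕ × ℕ × ℕ) × K) (k : SparsePoly K → SparsePoly K)
    (p : MvPolynomial (Fin 3) K) (hk : ∀ l, toMv (k l) = p + toMv l) (l : SparsePoly K) :
    toMv (addAux a k l) = term a + p + toMv l := by
  induction l with
  | nil => rw [addAux, toMv_cons, hk, add_assoc]
  | cons b bs ih =>
    rw [addAux]
    cases h1 : keyLt a.1 b.1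
    · cases h2 : keyEq a.1 b.1
      · rw [cond_false, cond_false, toMv_cons, ih, toMv_cons]; ring
      · have hab := eq_of_keyEq h2
        have ht : term a + term b = term (a.1, a.2 + b.2) := by
          simp only [term, ← hab, C_add]; ring
        rw [cond_false, cond_true]
        split_ifs with h3
        · rw [h3] at ht
          rw [hk, toMv_cons]
          have : term ((a.1, 0) : (ℕ × ℕ × ℕ) × K) = 0 := by simp [term]
          linear_combination -ht - this
        · rw [toMv_cons, toMv_cons, hk, ← ht]; ring
    · rw [cond_true, toMv_cons, hk, add_assoc]

theorem toMv_add [DecidableEq K] (l m : SparsePoly K) : toMv (add l m) = toMv l + toMv m := by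
  induction l generalizing m with
  | nil => simp [add]
  | cons a l ih =>
    rw [toMv_cons]
    exact toMv_addAux a _ _ ih m

/-- Multiplication by a term. -/
def mulTerm (a : (ℕ × ℕ × ℕ) × K) (l : SparsePoly K) : SparsePoly K :=
  l.map fun b => ((a.1.1 + b.1.1, a.1.2.1 + b.1.2.1, a.1.2.2 + b.1.2.2), a.2 * b.2)

theorem toMv_mulTerm (a : (ℕ × ℕ × ℕ) × K) (l : SparsePoly K) :
    toMv (mulTerm a l) = term a * toMv l := by
  induction l with
  | nil => simp [mulTerm]
  | cons b l ih =>
    rw [mulTerm, List.map_cons, toMv_cons, toMv_cons, mul_add, ← ih]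
    simp only [term, C_mul, mulTerm]
    ring

/-- The product. -/
def mul [DecidableEq K] (l m : SparsePoly K) : SparsePoly K :=
  l.foldr (fun a r => add (mulTerm a m) r) []

theorem toMv_mul [DecidableEq K] (l m : SparsePoly K) : toMv (mul l m) = toMv l * toMv m := by
  induction l with
  | nil => simp [mul]
  | cons a l ih =>
    rw [toMv_cons, add_mul, ← ih, ← toMv_mulTerm, ← toMv_add]
    rfl

/-- The difference. -/
def sub [DecidableEq K] (l m : SparsePoly K) : SparsePoly K :=
  add l (mulTerm ((0, 0, 0), -1) m)

theorem toMv_sub [DecidableEq K] (l m : SparsePoly K) : toMv (sub l m) = toMv l - toMv m := by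
  rw [sub, toMv_add, toMv_mulTerm]
  simp [term, sub_eq_add_neg]

/-- The partial derivatives. -/
def deriv : Fin 3 → SparsePoly K → SparsePoly K
  | 0, l => (l.filter fun b => !Nat.beq b.1.1 0).map fun b =>
      ((b.1.1 - 1, b.1.2.1, b.1.2.2), b.1.1 * b.2)
  | 1, l => (l.filter fun b => !Nat.beq b.1.2.1 0).map fun b =>
      ((b.1.1, b.1.2.1 - 1, b.1.2.2), b.1.2.1 * b.2)
  | 2, l => (l.filter fun b => !Nat.beq b.1.2.2 0).map fun b =>
      ((b.1.1, b.1.2.1, b.1.2.2 - 1), b.1.2.2 * b.2)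

theorem pderiv_term (i : Fin 3) (a : (ℕ × ℕ × ℕ) × K) :
    pderiv i (term a) = toMv (deriv i [a]) := by
  obtain ⟨⟨p, q, r⟩, c⟩ := a
  fin_cases i
  · cases p with
    | zero => simp [term, deriv, Derivation.leibniz, Derivation.leibniz_pow]
    | succ n =>
      change _ = toMv [((n, q, r), ((n + 1 : ℕ) : K) * c)]
      simp [term, Derivation.leibniz, Derivation.leibniz_pow]
      ring
  · cases q with
    | zero => simp [term, deriv, Derivation.leibniz, Derivation.leibniz_pow]
    | succ n =>
      change _ = toMv [((p, n, r), ((n + 1 : ℕ) : K) * c)]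
      simp [term, Derivation.leibniz, Derivation.leibniz_pow]
      ring
  · cases r with
    | zero => simp [term, deriv, Derivation.leibniz, Derivation.leibniz_pow]
    | succ n =>
      change _ = toMv [((p, q, n), ((n + 1 : ℕ) : K) * c)]
      simp [term, Derivation.leibniz, Derivation.leibniz_pow]
      ring

theorem toMv_append (l m : SparsePoly K) : toMv (l ++ m) = toMv l + toMv m := by simp [toMv]

theorem deriv_cons (i : Fin 3) (a : (ℕ × ℕ × ℕ) × K) (l : SparsePoly K) :
    deriv i (a :: l) = deriv i [a] ++ deriv i l := by
  have h : a :: l = [a] ++ l := rfl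
  match i with
  | 0 => rw [h, deriv, List.filter_append, List.map_append]; rfl
  | 1 => rw [h, deriv, List.filter_append, List.map_append]; rfl
  | 2 => rw [h, deriv, List.filter_append, List.map_append]; rfl

theorem toMv_deriv (i : Fin 3) (l : SparsePoly K) : toMv (deriv i l) = pderiv i (toMv l) := by
  induction l with
  | nil => fin_cases i <;> simp [deriv]
  | cons a l ih => rw [deriv_cons, toMv_append, ih, toMv_cons, map_add, pderiv_term]

/-- Evaluation at a point. -/
def ev (x y z : K) (l : SparsePoly K) : K :=
  l.foldr (fun b r => b.2 * (x ^ b.1.1 * y ^ b.1.2.1 * z ^ b.1.2.2) + r) 0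

theorem eval_toMv (x y z : K) (l : SparsePoly K) : eval ![x, y, z] (toMv l) = ev x y z l := by
  induction l with
  | nil => simp [ev]
  | cons a l ih =>
    rw [toMv_cons, map_add, ih]
    simp [ev, term]

/-- Powers. -/
def pow [DecidableEq K] (l : SparsePoly K) : ℕ → SparsePoly K
  | 0 => [((0, 0, 0), 1)]
  | n + 1 => mul l (pow l n)

theorem toMv_pow [DecidableEq K] (l : SparsePoly K) (n : ℕ) : toMv (pow l n) = toMv l ^ n := by
  induction n with
  | zero => simp [pow, term]
  | succ n ih => rw [pow, toMv_mul, ih, pow_succ']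

/-- Substitution of three polynomials for the variables. -/
def comp [DecidableEq K] (x y z : SparsePoly K) (l : SparsePoly K) : SparsePoly K :=
  l.foldr (fun b r => add (mulTerm ((0, 0, 0), b.2)
    (mul (pow x b.1.1) (mul (pow y b.1.2.1) (pow z b.1.2.2)))) r) []

theorem toMv_comp [DecidableEq K] (x y z l : SparsePoly K) :
    toMv (comp x y z l) = aeval ![toMv x, toMv y, toMv z] (toMv l) := by
  induction l with
  | nil => simp [comp]
  | cons a l ih =>
    rw [toMv_cons, map_add, ← ih]
    change toMv (add _ _) = _
    rw [toMv_add, toMv_mulTerm]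
    refine congrArg₂ (· + ·) ?_ rfl
    simp only [toMv_mul, toMv_pow, term, map_mul, map_pow, aeval_X, aeval_C, algebraMap_eq,
      pow_zero, mul_one, Matrix.cons_val_zero, Matrix.cons_val_one, Matrix.cons_val]
    ring

/-- A linear form. -/
def linear (a b c : K) : SparsePoly K := [((0, 0, 1), c), ((0, 1, 0), b), ((1, 0, 0), a)]

theorem toMv_linear (a b c : K) : toMv (linear a b c) = C a * X 0 + C b * X 1 + C c * X 2 := by
  simp [linear, term]; ring

/-- The determinant of the Hessian. -/
def hess [DecidableEq K] (f : SparsePoly K) : SparsePoly K :=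
  let a := deriv 0 (deriv 0 f)
  let b := deriv 0 (deriv 1 f)
  let c := deriv 0 (deriv 2 f)
  let d := deriv 1 (deriv 1 f)
  let e := deriv 1 (deriv 2 f)
  let g := deriv 2 (deriv 2 f)
  add (mul a (sub (mul d g) (mul e e)))
    (add (mul b (sub (mul e c) (mul b g))) (mul c (sub (mul b e) (mul d c))))

end SparsePoly

/-! ### Determinant formulas over any ring, and evaluation by dual numbers -/

section Formulas

variable {K : Type*} [CommRing K]

/-- The determinant of the Hessian. -/
noncomputable def hessDet (f : MvPolynomial (Fin 3) K) : MvPolynomial (Fin 3) K :=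
  detThree (pderiv 0 (pderiv 0 f)) (pderiv 0 (pderiv 1 f)) (pderiv 0 (pderiv 2 f))
    (pderiv 0 (pderiv 1 f)) (pderiv 1 (pderiv 1 f)) (pderiv 1 (pderiv 2 f))
    (pderiv 0 (pderiv 2 f)) (pderiv 1 (pderiv 2 f)) (pderiv 2 (pderiv 2 f))

/-- The determinant of the bordered Hessian. -/
noncomputable def bordDet (f g : MvPolynomial (Fin 3) K) : MvPolynomial (Fin 3) K :=
  detBordered (pderiv 0 (pderiv 0 g)) (pderiv 0 (pderiv 1 g)) (pderiv 0 (pderiv 2 g))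
    (pderiv 1 (pderiv 1 g)) (pderiv 1 (pderiv 2 g)) (pderiv 2 (pderiv 2 g))
    (pderiv 0 f) (pderiv 1 f) (pderiv 2 f)

/-- The Jacobian determinant. -/
noncomputable def jacDet (f g h : MvPolynomial (Fin 3) K) : MvPolynomial (Fin 3) K :=
  detThree (pderiv 0 h) (pderiv 1 h) (pderiv 2 h) (pderiv 0 f) (pderiv 1 f) (pderiv 2 f)
    (pderiv 0 g) (pderiv 1 g) (pderiv 2 g)

theorem map_hessDet {L : Type*} [CommRing L] (φ : K →+* L) (f : MvPolynomial (Fin 3) K) :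
    map φ (hessDet f) = hessDet (map φ f) := by
  simp [hessDet, detThree, pderiv_map]

theorem map_bordDet {L : Type*} [CommRing L] (φ : K →+* L) (f g : MvPolynomial (Fin 3) K) :
    map φ (bordDet f g) = bordDet (map φ f) (map φ g) := by
  simp [bordDet, detBordered, pderiv_map]

theorem map_jacDet {L : Type*} [CommRing L] (φ : K →+* L) (f g h : MvPolynomial (Fin 3) K) :
    map φ (jacDet f g h) = jacDet (map φ f) (map φ g) (map φ h) := by
  simp [jacDet, detThree, pderiv_map]

/-- The commutator is a derivation, so it suffices that it kills the variables. -/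
theorem pderiv_comm (i j : Fin 3) (f : MvPolynomial (Fin 3) K) :
    pderiv i (pderiv j f) = pderiv j (pderiv i f) := by
  have h : ⁅(pderiv i : Derivation K (MvPolynomial (Fin 3) K) (MvPolynomial (Fin 3) K)),
      (pderiv j : Derivation K (MvPolynomial (Fin 3) K) (MvPolynomial (Fin 3) K))⁆ = 0 := by
    refine derivation_ext fun k => ?_
    rw [Derivation.commutator_apply, pderiv_X, pderiv_X, Pi.single_apply, Pi.single_apply]
    split_ifs <;> simp
  have := DFunLike.congr_fun h f
  rwa [Derivation.commutator_apply, Derivation.zero_apply, sub_eq_zero] at this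

theorem hessDet_smul (a : K) (f : MvPolynomial (Fin 3) K) :
    hessDet (a • f) = a ^ 3 • hessDet f := by
  simp only [hessDet, detThree, smul_eq_C_mul, pderiv_C_mul, C_pow]
  ring

theorem bordDet_smul (a b : K) (f g : MvPolynomial (Fin 3) K) :
    bordDet (a • f) (b • g) = (a ^ 2 * b ^ 2) • bordDet f g := by
  simp only [bordDet, detBordered, smul_eq_C_mul, pderiv_C_mul, C_pow, C_mul]
  ring

theorem jacDet_smul (a b c : K) (f g h : MvPolynomial (Fin 3) K) :
    jacDet (a • f) (b • g) (c • h) = (a * b * c) • jacDet f g h := by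
  simp only [jacDet, detThree, smul_eq_C_mul, pderiv_C_mul, C_mul]
  ring

/-- Evaluation at `x + ε w` in the dual numbers. -/
noncomputable def dualEval (x w : Fin 3 → K) : MvPolynomial (Fin 3) K →ₐ[K] DualNumber K :=
  aeval fun i => TrivSqZeroExt.inl (x i) + TrivSqZeroExt.inr (w i)

theorem dualEval_eq (x w : Fin 3 → K) (f : MvPolynomial (Fin 3) K) : dualEval x w f =
    TrivSqZeroExt.inl (eval x f) + TrivSqZeroExt.inr (∑ k, w k * eval x (pderiv k f)) := by
  induction f using MvPolynomial.induction_on with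
  | C a =>
    simp [dualEval, TrivSqZeroExt.algebraMap_eq_inl]
  | add p q hp hq =>
    simp only [map_add, hp, hq, mul_add, Finset.sum_add_distrib, TrivSqZeroExt.inl_add,
      TrivSqZeroExt.inr_add]
    ring
  | mul_X p n hp =>
    rw [map_mul, hp]
    ext
    · simp [dualEval]
    · simp only [dualEval, Derivation.leibniz, pderiv_X, Pi.single_apply]
      simp only [apply_ite, aeval_X, smul_eq_mul, mul_one, mul_zero, map_add, map_mul,
        eval_X, map_zero, mul_add, Finset.sum_add_distrib, Finset.sum_ite_eq,
        Finset.mem_univ, if_true, TrivSqZeroExt.snd_add, TrivSqZeroExt.snd_mul, TrivSqZeroExt.fst_add,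
        TrivSqZeroExt.fst_inl, TrivSqZeroExt.fst_inr, TrivSqZeroExt.snd_inl,
        TrivSqZeroExt.snd_inr, add_zero, zero_add, op_smul_eq_mul, mul_zero, Finset.sum_mul]
      refine (add_comm _ _).trans
        (congrArg₂ (· + ·) (mul_comm _ _) (Finset.sum_congr rfl fun k _ => ?_))
      ring

/-- The Jacobian is the derivative of h in the direction ∇f × ∇g. A dual-number evaluation therefore
suffices, and the bordered Hessian of degree 30 never has to be expanded. -/
theorem eval_jacDet (x : Fin 3 → K) (f g h : MvPolynomial (Fin 3) K) :
    eval x (jacDet f g h) = (dualEval x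
      ![eval x (pderiv 1 f) * eval x (pderiv 2 g) - eval x (pderiv 2 f) * eval x (pderiv 1 g),
        eval x (pderiv 2 f) * eval x (pderiv 0 g) - eval x (pderiv 0 f) * eval x (pderiv 2 g),
        eval x (pderiv 0 f) * eval x (pderiv 1 g) - eval x (pderiv 1 f) * eval x (pderiv 0 g)]
      h).snd := by
  rw [dualEval_eq]
  simp [jacDet, detThree, Fin.sum_univ_three]
  ring

end Formulas

theorem det_hessian_eq (f : Poly) : (hessian f).det = hessDet f := by
  simp only [hessian, Matrix.det_fin_three, Matrix.of_apply, hessDet, detThree,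
    pderiv_comm 1 0 f, pderiv_comm 2 0 f, pderiv_comm 2 1 f]
  ring

theorem jac_eq_jacDet (f g h : Poly) : jac f g h = jacDet f g h := by
  rw [jac_eq, jacDet, detThree]
  ring

theorem det_fromBlocks_replicate {A : Type*} [CommRing A] {M : Matrix (Fin 3) (Fin 3) A}
    (hM : M.IsSymm) (u : Fin 3 → A) :
    (Matrix.fromBlocks M (Matrix.replicateCol Unit u) (Matrix.replicateRow Unit u) 0).det =
      detBordered (M 0 0) (M 0 1) (M 0 2) (M 1 1) (M 1 2) (M 2 2) (u 0) (u 1) (u 2) := by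
  have h : (Matrix.fromBlocks M (Matrix.replicateCol Unit u) (Matrix.replicateRow Unit u) 0).det =
      Matrix.det !![M 0 0, M 0 1, M 0 2, u 0; M 1 0, M 1 1, M 1 2, u 1;
        M 2 0, M 2 1, M 2 2, u 2; u 0, u 1, u 2, 0] := by
    rw [← Matrix.det_reindex_self ((Equiv.sumCongr (Equiv.refl (Fin 3))
      (Equiv.ofUnique Unit (Fin 1))).trans finSumFinEquiv)]
    congr 1
    ext1 i j
    fin_cases i <;> fin_cases j <;> rfl
  rw [h, hM.apply 0 1, hM.apply 0 2, hM.apply 1 2, detBordered]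
  simp [Matrix.det_succ_row_zero, Fin.sum_univ_succ, Fin.succAbove]
  ring

theorem det_borderedHessian_eq (f g : Poly) : (borderedHessian f g).det = bordDet f g :=
  det_fromBlocks_replicate (Matrix.IsSymm.ext fun i j => pderiv_comm j i g) _

namespace SparsePoly

variable {K : Type*} [CommRing K]

theorem toMv_hess [DecidableEq K] (f : SparsePoly K) : toMv (hess f) = hessDet (toMv f) := by
  simp only [hess, toMv_add, toMv_mul, toMv_sub, toMv_deriv, hessDet, detThree]
  ring

/-- Evaluation in the dual numbers. -/
def evDual (x y z u v w : K) (l : SparsePoly K) : DualNumber K :=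
  (ev x y z l, u * ev x y z (deriv 0 l) + v * ev x y z (deriv 1 l) + w * ev x y z (deriv 2 l))

theorem dualEval_toMv (x y z u v w : K) (l : SparsePoly K) :
    dualEval ![x, y, z] ![u, v, w] (toMv l) = evDual x y z u v w l := by
  rw [dualEval_eq, Fin.sum_univ_three]
  simp only [← toMv_deriv, eval_toMv, evDual]
  ext <;> simp

/-- The bordered Hessian determinant in the dual numbers. -/
def bordDual (x y z u v w : K) (f g : SparsePoly K) : DualNumber K :=
  let E := evDual x y z u v w
  detBordered (E (deriv 0 (deriv 0 g))) (E (deriv 0 (deriv 1 g))) (E (deriv 0 (deriv 2 g)))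
    (E (deriv 1 (deriv 1 g))) (E (deriv 1 (deriv 2 g))) (E (deriv 2 (deriv 2 g)))
    (E (deriv 0 f)) (E (deriv 1 f)) (E (deriv 2 f))

/-- The value at a point of the Jacobian of a form, its Hessian and its bordered Hessian. -/
def jacValue (x y z : K) (f g : SparsePoly K) : K :=
  let f0 := ev x y z (deriv 0 f)
  let f1 := ev x y z (deriv 1 f)
  let f2 := ev x y z (deriv 2 f)
  let g0 := ev x y z (deriv 0 g)
  let g1 := ev x y z (deriv 1 g)
  let g2 := ev x y z (deriv 2 g)
  (bordDual x y z (f1 * g2 - f2 * g1) (f2 * g0 - f0 * g2) (f0 * g1 - f1 * g0) f g).snd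

theorem eval_jacDet_eq_jacValue (x y z : K) (f g : SparsePoly K) :
    eval ![x, y, z] (jacDet (toMv f) (toMv g) (bordDet (toMv f) (toMv g))) =
      jacValue x y z f g := by
  rw [eval_jacDet]
  simp only [bordDet, detBordered, map_add, map_mul, map_sub, map_ofNat, ← toMv_deriv,
    dualEval_toMv, eval_toMv]
  rfl

end SparsePoly

/-! ### The explicit sextic: invariance, sum of cubes, nonzero Jacobian -/

open SparsePoly

/-- Twice the Valentiner sextic, normalized to have leading coefficients `1`. -/
def sextic : SparsePoly Coef :=
  [((0, 0, 6), coef 2 0 0 0), ((0, 2, 4), coef 9 (-3) 6 3), ((0, 4, 2), coef (-3) 6 (-9) 3),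
    ((0, 6, 0), coef 2 0 0 0), ((2, 0, 4), coef (-3) 6 (-9) 3),
    ((2, 2, 2), coef 36 (-12) 12 (-24)), ((2, 4, 0), coef 9 (-3) 6 3),
    ((4, 0, 2), coef 9 (-3) 6 3), ((4, 2, 0), coef (-3) 6 (-9) 3), ((6, 0, 0), coef 2 0 0 0)]

theorem jacValue_sextic_ne_zero :
    jacValue 1 1 2 sextic (SparsePoly.hess sextic) ≠ 0 := by
  decide +kernel

/-- The integral matrix `m` over `ℤ[τ, ρ]` is twice the complex matrix `M`. -/
def IsDouble (M : Matrix.SpecialLinearGroup (Fin 3) ℂ) (m : Matrix (Fin 3) (Fin 3) Coef) : Prop :=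
  coefHom.mapMatrix m = (2 : ℂ) • (M : Matrix (Fin 3) (Fin 3) ℂ)

/-- Doubling clears the denominators of P; since (2M)(2N) = 2(2MN), one factor 2 has to be removed.
-/
theorem IsDouble.mul {M N : Matrix.SpecialLinearGroup (Fin 3) ℂ}
    {m n k : Matrix (Fin 3) (Fin 3) Coef} (hM : IsDouble M m) (hN : IsDouble N n)
    (h : m * n = 2 * k) : IsDouble (M * N) k := by
  have h1 := congrArg coefHom.mapMatrix h
  rw [map_mul, hM, hN, map_mul, map_ofNat] at h1
  rw [IsDouble, Matrix.SpecialLinearGroup.coe_mul]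
  have h2 : (2 : ℂ) • coefHom.mapMatrix k = 2 * coefHom.mapMatrix k := by
    rw [two_smul, two_mul]
  rw [← h2, Matrix.smul_mul, Matrix.mul_smul] at h1
  exact (smul_right_injective _ (two_ne_zero (α := ℂ)) h1).symm

theorem IsDouble.inv {M : Matrix.SpecialLinearGroup (Fin 3) ℂ}
    {m n : Matrix (Fin 3) (Fin 3) Coef} (hM : IsDouble M m) (h : m * n = 4) :
    IsDouble M⁻¹ n := by
  have h1 := congrArg coefHom.mapMatrix h
  rw [map_mul, hM, map_ofNat] at h1
  have h2 : ((M⁻¹ : Matrix.SpecialLinearGroup (Fin 3) ℂ) : Matrix (Fin 3) (Fin 3) ℂ) *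
      (M : Matrix (Fin 3) (Fin 3) ℂ) = 1 := by
    rw [← Matrix.SpecialLinearGroup.coe_mul, inv_mul_cancel, Matrix.SpecialLinearGroup.coe_one]
  have h3 : (2 : ℂ) • coefHom.mapMatrix n = (4 : ℂ) •
      ((M⁻¹ : Matrix.SpecialLinearGroup (Fin 3) ℂ) : Matrix (Fin 3) (Fin 3) ℂ) := by
    calc (2 : ℂ) • coefHom.mapMatrix n
        = ((M⁻¹ : Matrix.SpecialLinearGroup (Fin 3) ℂ) : Matrix (Fin 3) (Fin 3) ℂ) *
          (((2 : ℂ) • (M : Matrix (Fin 3) (Fin 3) ℂ)) * coefHom.mapMatrix n) := by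
          rw [Matrix.smul_mul, Matrix.mul_smul, ← Matrix.mul_assoc, h2, Matrix.one_mul]
      _ = _ := by
          rw [h1]
          ext i j
          simp [Matrix.mul_apply, Matrix.ofNat_apply, mul_comm]
  rw [show (4 : ℂ) = 2 * 2 by norm_num, mul_smul] at h3
  exact smul_right_injective _ (two_ne_zero (α := ℂ)) h3

/-- Twice the matrix of `Z₁`. -/
def matZ : Matrix (Fin 3) (Fin 3) Coef := !![2, 0, 0; 0, -2, 0; 0, 0, -2]

/-- Twice the matrix of `T₁`. -/
def matT : Matrix (Fin 3) (Fin 3) Coef := !![0, 0, 2; 2, 0, 0; 0, 2, 0]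

/-- Twice the matrix of `P`. -/
def matP : Matrix (Fin 3) (Fin 3) Coef :=
  !![1, coef (-1) 1 0 0, coef 0 (-1) 0 0; coef (-1) 1 0 0, coef 0 1 0 0, 1;
    coef 0 1 0 0, -1, coef (-1) 1 0 0]

/-- Twice the matrix of `P²`. -/
def matPP : Matrix (Fin 3) (Fin 3) Coef :=
  !![coef 1 (-1) 0 0, coef 0 1 0 0, -1; coef 0 1 0 0, 1, coef (-1) 1 0 0;
    1, coef 1 (-1) 0 0, coef 0 (-1) 0 0]

/-- Twice the matrix of `Q`. -/
def matQ : Matrix (Fin 3) (Fin 3) Coef :=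
  !![2, 0, 0; 0, 0, coef (-2) 0 (-2) 0; 0, coef 0 0 (-2) 0, 0]

/-- Twice the matrix of `Q⁻¹`. -/
def matQi : Matrix (Fin 3) (Fin 3) Coef :=
  !![2, 0, 0; 0, 0, coef 2 0 2 0; 0, coef 0 0 2 0, 0]

/-- Twice the matrix of `ρ I`. -/
def matS : Matrix (Fin 3) (Fin 3) Coef :=
  !![coef 0 0 2 0, 0, 0; 0, coef 0 0 2 0, 0; 0, 0, coef 0 0 2 0]

theorem coefHom_coef (a b c d : ℤ) :
    coefHom (coef a b c d) = (a + b * tau) + (c + d * tau) * rho := rfl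

theorem coefHom_two : coefHom 2 = 2 := map_ofNat coefHom 2

theorem tau_inv : tau⁻¹ = tau - 1 :=
  inv_eq_of_mul_eq_one_right (by linear_combination tau_sq)

theorem isDouble_Z : IsDouble genZ matZ := by
  ext i j
  fin_cases i <;> fin_cases j <;> simp [matZ, genZ, coefHom_two]

theorem isDouble_T : IsDouble genT matT := by
  ext i j
  fin_cases i <;> fin_cases j <;> simp [matT, genT, coefHom_two]

theorem isDouble_P : IsDouble genP matP := by
  ext i j
  fin_cases i <;> fin_cases j <;> simp [matP, genP, coefHom_coef, tau_inv] <;> ring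

theorem isDouble_Q : IsDouble genQ matQ := by
  ext i j
  fin_cases i <;> fin_cases j <;> simp [matQ, genQ, coefHom_coef, coefHom_two]
  linear_combination (-2 : ℂ) * rho_sq

theorem isDouble_S : IsDouble genScalar matS := by
  ext i j
  fin_cases i <;> fin_cases j <;> simp [matS, genScalar, coefHom_coef]

theorem isDouble_Q_inv : IsDouble genQ⁻¹ matQi := isDouble_Q.inv (by decide +kernel)

/-- P is real orthogonal, so its inverse is its transpose; it has order five, so P⁻³ = P² and P⁻⁴ =
P in the lemmas that follow. -/
theorem isDouble_P_inv : IsDouble genP⁻¹ matPᵀ := isDouble_P.inv (by decide +kernel)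

theorem isDouble_P_inv_sq : IsDouble (genP⁻¹ ^ 2) matPPᵀ := by
  rw [sq]; exact isDouble_P_inv.mul isDouble_P_inv (by decide +kernel)

theorem isDouble_P_inv_cube : IsDouble (genP⁻¹ ^ 3) matPP := by
  rw [pow_succ]; exact isDouble_P_inv_sq.mul isDouble_P_inv (by decide +kernel)

theorem isDouble_P_inv_four : IsDouble (genP⁻¹ ^ 4) matP := by
  rw [pow_succ]; exact isDouble_P_inv_cube.mul isDouble_P_inv (by decide +kernel)

/-- The complex polynomial represented by a list of terms over `ℤ[τ, ρ]`. -/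
noncomputable def toPoly (l : SparsePoly Coef) : Poly := map coefHom (toMv l)

/-- The polynomial `f(m x)`. -/
def act (m : Matrix (Fin 3) (Fin 3) Coef) (l : SparsePoly Coef) : SparsePoly Coef :=
  comp (linear (m 0 0) (m 0 1) (m 0 2)) (linear (m 1 0) (m 1 1) (m 1 2))
    (linear (m 2 0) (m 2 1) (m 2 2)) l

theorem eval_map_aeval {K L : Type*} [CommRing K] [CommRing L] (φ : K →+* L)
    (g : Fin 3 → MvPolynomial (Fin 3) K) (p : MvPolynomial (Fin 3) K) (x : Fin 3 → L) :
    eval x (map φ (aeval g p)) = eval (fun i => eval x (map φ (g i))) (map φ p) := by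
  induction p using MvPolynomial.induction_on with
  | C a => simp
  | add p q hp hq => simp only [map_add, hp, hq]
  | mul_X p n hp => simp only [map_mul, hp, aeval_X, map_X, eval_X]

theorem eval_mul_of_isHomogeneous {K : Type*} [CommRing K] {p : MvPolynomial (Fin 3) K} {n : ℕ}
    (hp : p.IsHomogeneous n) (c : K) (x : Fin 3 → K) :
    eval (fun i => c * x i) p = c ^ n * eval x p := by
  rw [eval_eq', eval_eq', Finset.mul_sum]
  refine Finset.sum_congr rfl fun d hd => ?_
  have h1 : d.degree = n := by
    by_contra h
    exact mem_support_iff.1 hd (hp.coeff_eq_zero h)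
  simp_rw [mul_pow]
  rw [Finset.prod_mul_distrib, Finset.prod_pow_eq_pow_sum, ← Finsupp.degree_eq_sum, h1]
  ring

theorem toPoly_act {M : Matrix.SpecialLinearGroup (Fin 3) ℂ}
    {m : Matrix (Fin 3) (Fin 3) Coef} (hM : IsDouble M m) {l : SparsePoly Coef} {n : ℕ}
    (hl : (toPoly l).IsHomogeneous n) :
    toPoly (act m l) = (2 : ℂ) ^ n • substHom M (toPoly l) := by
  have hentry : ∀ i j, coefHom (m i j) = 2 * (M : Matrix (Fin 3) (Fin 3) ℂ) i j := fun i j =>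
    congrFun (congrFun hM i) j
  refine funext fun x => ?_
  rw [smul_eval, eval_substHom, ← eval_mul_of_isHomogeneous hl, toPoly, act, toMv_comp,
    eval_map_aeval]
  refine congrArg (fun y => eval y (toPoly l)) (_root_.funext fun i => ?_)
  fin_cases i <;> simp [toMv_linear, hentry, Matrix.mulVec, dotProduct, Fin.sum_univ_three] <;>
    ring

theorem toPoly_add (l m : SparsePoly Coef) : toPoly (add l m) = toPoly l + toPoly m := by
  rw [toPoly, toMv_add, map_add]; rfl

theorem toPoly_mulTerm (c : Coef) (l : SparsePoly Coef) :
    toPoly (mulTerm ((0, 0, 0), c) l) = coefHom c • toPoly l := by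
  rw [toPoly, toMv_mulTerm, map_mul]
  simp [term, smul_eq_C_mul, toPoly]

theorem isHomogeneous_toPoly {l : SparsePoly Coef} {n : ℕ}
    (h : ∀ a ∈ l, a.1.1 + a.1.2.1 + a.1.2.2 = n) : (toPoly l).IsHomogeneous n := by
  rw [toPoly]
  refine IsHomogeneous.map ?_ _
  induction l with
  | nil => exact isHomogeneous_zero _ _ _
  | cons a l ih =>
    rw [toMv_cons]
    refine IsHomogeneous.add ?_ (ih fun b hb => h b (List.mem_cons_of_mem _ hb))
    rw [term, ← h a List.mem_cons_self, mul_assoc]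
    have := (((isHomogeneous_X_pow (R := Coef) (0 : Fin 3) a.1.1).mul
      (isHomogeneous_X_pow 1 a.1.2.1)).mul (isHomogeneous_X_pow 2 a.1.2.2)).C_mul a.2
    rwa [mul_assoc] at this

/-- The sextic as a complex form. -/
noncomputable def sexticForm : Poly := toPoly sextic

theorem isHomogeneous_sexticForm : sexticForm.IsHomogeneous 6 :=
  isHomogeneous_toPoly (by decide +kernel)

/-- The integral matrix is 2M and the form has degree 6, whence 64 = 2⁶. -/
theorem substHom_sexticForm {M : Matrix.SpecialLinearGroup (Fin 3) ℂ}
    {m : Matrix (Fin 3) (Fin 3) Coef} (hM : IsDouble M m)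
    (h : act m sextic = mulTerm ((0, 0, 0), coef 64 0 0 0) sextic) :
    substHom M sexticForm = sexticForm := by
  have h1 := toPoly_act hM isHomogeneous_sexticForm
  rw [h, toPoly_mulTerm, coefHom_coef] at h1
  refine smul_right_injective _ (pow_ne_zero 6 (two_ne_zero (α := ℂ))) ?_
  refine h1.symm.trans ?_
  norm_num
  rfl

theorem isInvariant_sexticForm : IsInvariant sexticForm :=
  isInvariant_of_generators (substHom_sexticForm isDouble_Z (by decide +kernel))
    (substHom_sexticForm isDouble_T (by decide +kernel))
    (substHom_sexticForm isDouble_P (by decide +kernel))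
    (substHom_sexticForm isDouble_Q (by decide +kernel))
    (substHom_sexticForm isDouble_S (by decide +kernel))

/-- The conic `x₁² + x₂² + x₃²`. -/
def conicList : SparsePoly Coef := [((0, 0, 2), 1), ((0, 2, 0), 1), ((2, 0, 0), 1)]

theorem toPoly_conicList : toPoly conicList = conicOne := by
  simp [toPoly, conicList, term, conicOne]; ring

/-- Sixteen times the six conics. -/
def conicLists : Fin 6 → SparsePoly Coef :=
  ![mulTerm ((0, 0, 0), 16) conicList, mulTerm ((0, 0, 0), 4) (act matQi conicList),
    act matP (act matQi conicList), act matPP (act matQi conicList),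
    act matPPᵀ (act matQi conicList), act matPᵀ (act matQi conicList)]

theorem toPoly_conicTwo : toPoly (act matQi conicList) = (4 : ℂ) • conicTwo := by
  rw [toPoly_act isDouble_Q_inv (isHomogeneous_toPoly (n := 2) (by decide +kernel)),
    toPoly_conicList, conicTwo, subst_eq_substHom]
  norm_num

/-- Two substitutions by doubled matrices into a quadratic form each contribute 2² = 4. -/
theorem toPoly_act_conicTwo {M : Matrix.SpecialLinearGroup (Fin 3) ℂ}
    {m : Matrix (Fin 3) (Fin 3) Coef} (hM : IsDouble M m) :
    toPoly (act m (act matQi conicList)) = (16 : ℂ) • subst M conicTwo := by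
  rw [toPoly_act hM (isHomogeneous_toPoly (n := 2) (by decide +kernel)), toPoly_conicTwo,
    map_smul, smul_smul, subst_eq_substHom]
  norm_num

theorem toPoly_conicLists (m : Fin 6) : toPoly (conicLists m) = (16 : ℂ) • conic m := by
  match m with
  | 0 =>
    change toPoly (mulTerm _ _) = (16 : ℂ) • conicOne
    rw [toPoly_mulTerm, toPoly_conicList, map_ofNat]
  | 1 =>
    change toPoly (mulTerm _ _) = (16 : ℂ) • conicTwo
    rw [toPoly_mulTerm, toPoly_conicTwo, map_ofNat, smul_smul]
    norm_num
  | 2 =>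
    change toPoly (act matP _) = (16 : ℂ) • subst (genP⁻¹ ^ 4) conicTwo
    exact toPoly_act_conicTwo isDouble_P_inv_four
  | 3 =>
    change toPoly (act matPP _) = (16 : ℂ) • subst (genP⁻¹ ^ 3) conicTwo
    exact toPoly_act_conicTwo isDouble_P_inv_cube
  | 4 =>
    change toPoly (act matPPᵀ _) = (16 : ℂ) • subst (genP⁻¹ ^ 2) conicTwo
    exact toPoly_act_conicTwo isDouble_P_inv_sq
  | 5 =>
    change toPoly (act matPᵀ _) = (16 : ℂ) • subst genP⁻¹ conicTwo
    exact toPoly_act_conicTwo isDouble_P_inv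

/-- The sum of the cubes of the conics. -/
def cubeSum : SparsePoly Coef :=
  add (pow (conicLists 0) 3) (add (pow (conicLists 1) 3) (add (pow (conicLists 2) 3)
    (add (pow (conicLists 3) 3) (add (pow (conicLists 4) 3) (pow (conicLists 5) 3)))))

theorem cubeSum_eq : cubeSum = mulTerm ((0, 0, 0), coef 4992 (-384) 384 (-768)) sextic := by
  decide +kernel

theorem toPoly_pow (l : SparsePoly Coef) (n : ℕ) : toPoly (pow l n) = toPoly l ^ n := by
  rw [toPoly, toMv_pow, map_pow]; rfl

theorem exists_sum_conic_cubes :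
    ∃ k : ℂ, k ≠ 0 ∧ ∑ m : Fin 6, conic m ^ 3 = k • sexticForm := by
  have h := congrArg toPoly cubeSum_eq
  simp only [cubeSum, toPoly_add, toPoly_pow, toPoly_conicLists, toPoly_mulTerm, smul_pow] at h
  refine ⟨((16 : ℂ) ^ 3)⁻¹ * coefHom (coef 4992 (-384) 384 (-768)), mul_ne_zero (by norm_num)
    ((map_ne_zero_iff _ coefHom_injective).2 (by decide +kernel)), ?_⟩
  rw [mul_smul, sexticForm, ← h, ← smul_add, ← smul_add, ← smul_add, ← smul_add, ← smul_add,
    inv_smul_smul₀ (by norm_num)]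
  simp only [Fin.sum_univ_succ, Finset.univ_eq_empty, Finset.sum_empty, add_zero]
  rfl

/-- The determinants commute with the injective `coefHom`, so it is enough to find a nonzero value
over ℤ[τ, ρ]. -/
theorem jac_sexticForm_ne_zero : jac sexticForm (hessian sexticForm).det
    (borderedHessian sexticForm (hessian sexticForm).det).det ≠ 0 := by
  rw [jac_eq_jacDet, det_borderedHessian_eq, det_hessian_eq, sexticForm, toPoly, ← map_hessDet,
    ← map_bordDet, ← map_jacDet, ← toMv_hess]
  refine (map_ne_zero_iff _ (map_injective _ coefHom_injective)).2 fun h => ?_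
  apply jacValue_sextic_ne_zero
  rw [← eval_jacDet_eq_jacValue, h, map_zero]

/-! ### The forty-five mirrors and invariants of odd degree -/

/-- The linear form with coefficients `v`. -/
noncomputable def linForm (v : Fin 3 → ℂ) : Poly := ∑ i, C (v i) * X i

theorem eval_linForm (v x : Fin 3 → ℂ) : eval x (linForm v) = v ⬝ᵥ x := by
  simp [linForm, dotProduct]

theorem linForm_smul (a : ℂ) (v : Fin 3 → ℂ) : linForm (a • v) = C a * linForm v := by
  simp [linForm, Finset.mul_sum, mul_assoc]

theorem isHomogeneous_linForm (v : Fin 3 → ℂ) : (linForm v).IsHomogeneous 1 :=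
  IsHomogeneous.sum _ _ _ fun _ _ => isHomogeneous_C_mul_X _ _

theorem substHom_linForm (M : Matrix.SpecialLinearGroup (Fin 3) ℂ) (v : Fin 3 → ℂ) :
    substHom M (linForm v) = linForm (v ᵥ* (M : Matrix (Fin 3) (Fin 3) ℂ)) :=
  funext fun x => by
    rw [eval_substHom, eval_linForm, eval_linForm, Matrix.dotProduct_mulVec]

/-- The form vanishing on a mirror divides invariants of odd degree. -/
theorem X_dvd_of_odd {f : Poly} {d : ℕ} (hd : Odd d) (hf : f.IsHomogeneous d)
    (hinv : IsInvariant f) : X 0 ∣ f := by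
  -- Modulo X₀ a polynomial equals its restriction to the plane x₀ = 0, so it remains to see that f
  -- vanishes there.
  have h1 : ∀ g : Poly, X 0 ∣ g - aeval ![(0 : Poly), X 1, X 2] g := fun g => by
    induction g using MvPolynomial.induction_on with
    | C a => simp
    | add p q hp hq =>
      rw [map_add, add_sub_add_comm]
      exact dvd_add hp hq
    | mul_X p n hp =>
      rw [map_mul, aeval_X]
      have h2 : (X 0 : Poly) ∣ X n - (![(0 : Poly), X 1, X 2] : Fin 3 → Poly) n := by
        fin_cases n <;> simp
      have h3 := dvd_add (hp.mul_right (X n))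
        (h2.mul_left (aeval ![(0 : Poly), X 1, X 2] p))
      refine h3.trans (dvd_of_eq ?_)
      ring
  have h2 : aeval ![(0 : Poly), X 1, X 2] f = 0 := funext fun x => by
    have e1 : eval x (aeval ![(0 : Poly), X 1, X 2] f) = eval ![0, x 1, x 2] f := by
      have := eval_map_aeval (RingHom.id ℂ) ![(0 : Poly), X 1, X 2] f x
      rw [map_id, map_id] at this
      rw [this]
      refine congrArg (fun y => eval y f) (_root_.funext fun i => ?_)
      fin_cases i <;> simp
    -- On this plane Z₁ acts as -1, so f(-x) = f(x) by invariance, while f(-x) = -f(x) by odd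
    -- degree.
    have e2 : eval (fun i => -1 * (![0, x 1, x 2] : Fin 3 → ℂ) i) f = eval ![0, x 1, x 2] f := by
      conv_rhs => rw [← hinv genZ (Subgroup.subset_closure (by simp)), eval_substHom]
      refine congrArg (fun y => eval y f) (_root_.funext fun i => ?_)
      fin_cases i <;> simp [genZ, Matrix.mulVec, dotProduct, Fin.sum_univ_three]
    rw [eval_mul_of_isHomogeneous hf, hd.neg_one_pow] at e2
    rw [e1, map_zero]
    linear_combination (-1 / 2 : ℂ) * e2
  have h3 := h1 f
  rwa [h2, sub_zero] at h3

/-- The linear form is a multiple of an image of `X 0` under the Valentiner group. -/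
def IsMirror (v : Fin 3 → ℂ) : Prop :=
  ∃ T ∈ group, ∃ c : ℂ, c ≠ 0 ∧ linForm v = C c * substHom T (X 0)

theorem IsMirror.dvd {v : Fin 3 → ℂ} (hv : IsMirror v) {f : Poly} {d : ℕ} (hd : Odd d)
    (hf : f.IsHomogeneous d) (hinv : IsInvariant f) : linForm v ∣ f := by
  obtain ⟨T, hT, c, hc, h⟩ := hv
  have h1 := map_dvd (substHom T) (X_dvd_of_odd hd hf hinv)
  rw [hinv T hT] at h1
  rw [h]
  exact (IsUnit.mul_left_dvd ((isUnit_iff_ne_zero.2 hc).map C)).2 h1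

/-- A variable is prime, and substitution by a group element is a ring automorphism. -/
theorem IsMirror.prime {v : Fin 3 → ℂ} (hv : IsMirror v) : Prime (linForm v) := by
  obtain ⟨T, hT, c, hc, h⟩ := hv
  let e : Poly ≃* Poly :=
    { toFun := substHom T
      invFun := substHom T⁻¹
      left_inv := fun f => by rw [substHom_substHom, mul_inv_cancel, substHom_one]
      right_inv := fun f => by rw [substHom_substHom, inv_mul_cancel, substHom_one]
      map_mul' := map_mul _ }
  have h1 : Prime (substHom T (X 0)) := (MulEquiv.prime_iff e).2 (X_prime (i := (0 : Fin 3)))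
  have h2 : Associated (substHom T (X 0)) (linForm v) :=
    ⟨((isUnit_iff_ne_zero.2 hc).map C).unit, by rw [h, mul_comm]; rfl⟩
  exact h2.prime h1

/-- The product of a vector and a matrix. -/
def vecMulTriple (v : Coef × Coef × Coef) (m : Matrix (Fin 3) (Fin 3) Coef) :
    Coef × Coef × Coef :=
  (v.1 * m 0 0 + v.2.1 * m 1 0 + v.2.2 * m 2 0, v.1 * m 0 1 + v.2.1 * m 1 1 + v.2.2 * m 2 1,
    v.1 * m 0 2 + v.2.1 * m 1 2 + v.2.2 * m 2 2)

/-- The complex vector of a triple. -/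
noncomputable def toVec (v : Coef × Coef × Coef) : Fin 3 → ℂ :=
  ![coefHom v.1, coefHom v.2.1, coefHom v.2.2]

/-- Multiplying the coefficient row by a matrix is substitution into the form, so the orbit of X₀
can be followed along words in the generators; the doubled matrix only adds a factor 2. -/
theorem IsMirror.vecMulTriple {v : Coef × Coef × Coef} (hv : IsMirror (toVec v))
    {M : Matrix.SpecialLinearGroup (Fin 3) ℂ} {m : Matrix (Fin 3) (Fin 3) Coef} (hM : M ∈ group)
    (h : IsDouble M m) : IsMirror (toVec (vecMulTriple v m)) := by
  have hentry : ∀ i j, coefHom (m i j) = 2 * (M : Matrix (Fin 3) (Fin 3) ℂ) i j := fun i j =>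
    congrFun (congrFun h i) j
  obtain ⟨T, hT, c, hc, hl⟩ := hv
  refine ⟨T * M, mul_mem hT hM, 2 * c, mul_ne_zero two_ne_zero hc, ?_⟩
  have h1 : toVec (Valentiner.vecMulTriple v m) =
      (2 : ℂ) • (toVec v ᵥ* (M : Matrix (Fin 3) (Fin 3) ℂ)) := by
    ext i
    fin_cases i <;> simp [toVec, Valentiner.vecMulTriple, hentry, Matrix.vecMul, dotProduct,
      Fin.sum_univ_three] <;> ring
  rw [h1, linForm_smul, ← substHom_linForm, hl, map_mul, substHom_substHom, C_mul, mul_assoc]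
  congr 2
  exact algHom_C _ _

/-- The doubles of the generators. -/
def genMat : Fin 4 → Matrix (Fin 3) (Fin 3) Coef := ![matZ, matT, matP, matQ]

/-- The image of the first basis vector under a word in the generators. -/
def wordVec (w : List (Fin 4)) : Coef × Coef × Coef :=
  w.foldl (fun v g => vecMulTriple v (genMat g)) (1, 0, 0)

theorem isMirror_wordVec (w : List (Fin 4)) : IsMirror (toVec (wordVec w)) := by
  induction w using List.reverseRecOn with
  | nil =>
    refine ⟨1, one_mem _, 1, one_ne_zero, ?_⟩
    simp [wordVec, toVec, linForm, substHom_one, Fin.sum_univ_three]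
  | append_singleton w g ih =>
    rw [wordVec, List.foldl_append]
    fin_cases g
    · exact ih.vecMulTriple (Subgroup.subset_closure (by simp)) isDouble_Z
    · exact ih.vecMulTriple (Subgroup.subset_closure (by simp)) isDouble_T
    · exact ih.vecMulTriple (Subgroup.subset_closure (by simp)) isDouble_P
    · exact ih.vecMulTriple (Subgroup.subset_closure (by simp)) isDouble_Q

/-- Words representing the forty-five mirrors. -/
def mirrorWords : List (List (Fin 4)) :=
  [[], [1], [2], [1, 1], [1, 2], [2, 0], [2, 1], [2, 3], [1, 1, 2], [1, 2, 0], [1, 2, 1], [1,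
   2, 3], [2, 0, 1], [2, 0, 2], [2, 0, 3], [2, 1, 0], [2, 1, 3], [2, 3, 1], [2, 3, 2], [1, 1,
   2, 1], [1, 1, 2, 3], [1, 2, 1, 0], [1, 2, 1, 3], [1, 2, 3, 1], [1, 2, 3, 2], [2, 0, 2, 3],
   [2, 0, 3, 2], [2, 1, 0, 3], [2, 1, 3, 2], [2, 3, 2, 1], [2, 3, 2, 2], [2, 3, 2, 3], [1, 1,
   2, 1, 3], [1, 1, 2, 3, 2], [1, 2, 1, 3, 2], [1, 2, 3, 2, 1], [1, 2, 3, 2, 3], [2, 0, 2, 3,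
   2], [2, 0, 3, 2, 2], [2, 1, 0, 3, 2], [2, 3, 2, 1, 1], [2, 3, 2, 1, 2], [1, 1, 2, 1, 3, 2],
   [1, 1, 2, 3, 2, 1], [1, 2, 3, 2, 1, 1]]

/-- The cross product of triples. -/
def crossTriple (v w : Coef × Coef × Coef) : Coef × Coef × Coef :=
  (v.2.1 * w.2.2 - v.2.2 * w.2.1, v.2.2 * w.1 - v.1 * w.2.2, v.1 * w.2.1 - v.2.1 * w.1)

/-- If v divided w, then w would vanish at every v × y, since v does; the unit vectors y then force
v × w = 0. -/
theorem not_linForm_dvd {v w : Coef × Coef × Coef} (h : crossTriple v w ≠ 0) :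
    ¬ linForm (toVec v) ∣ linForm (toVec w) := by
  rintro ⟨q, hq⟩
  have hx : ∀ x : Fin 3 → ℂ, toVec v ⬝ᵥ x = 0 → toVec w ⬝ᵥ x = 0 := fun x hx => by
    rw [← eval_linForm, hq, map_mul, eval_linForm, hx, zero_mul]
  have key : ∀ y : Fin 3 → ℂ, toVec w ⬝ᵥ crossProduct (toVec v) y = 0 := fun y =>
    hx _ (dot_self_cross _ _)
  apply h
  have k0 := key ![1, 0, 0]
  have k1 := key ![0, 1, 0]
  have k2 := key ![0, 0, 1]
  simp only [cross_apply, dotProduct, Fin.sum_univ_three, toVec, Matrix.cons_val_zero,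
    Matrix.cons_val_one, Matrix.cons_val] at k0 k1 k2
  refine Prod.ext ?_ (Prod.ext ?_ ?_) <;> apply coefHom_injective <;>
    simp only [crossTriple, map_sub, map_mul, map_zero, Prod.fst_zero, Prod.snd_zero]
  · linear_combination -k0
  · linear_combination -k1
  · linear_combination -k2

theorem pairwise_mirrorWords :
    (mirrorWords.map wordVec).Pairwise fun v w => crossTriple v w ≠ 0 := by
  decide +kernel

theorem prod_dvd_of_pairwise {M : Type*} [CommMonoidWithZero M] [IsCancelMulZero M] {l : List M}
    {n : M} (hl : ∀ p ∈ l, Prime p) (hn : ∀ p ∈ l, p ∣ n)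
    (h : l.Pairwise fun p q => ¬ q ∣ p) : l.prod ∣ n := by
  induction l generalizing n with
  | nil => simp
  | cons a l ih =>
    rw [List.pairwise_cons] at h
    obtain ⟨k, rfl⟩ := hn a List.mem_cons_self
    rw [List.prod_cons]
    refine mul_dvd_mul_left a (ih (fun p hp => hl p (List.mem_cons_of_mem _ hp))
      (fun p hp => ?_) h.2)
    exact ((hl p (List.mem_cons_of_mem _ hp)).dvd_or_dvd
      (hn p (List.mem_cons_of_mem _ hp))).resolve_left (h.1 p hp)

/-- The product of the forty-five mirror forms. -/
noncomputable def mirrorProd : Poly :=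
  (mirrorWords.map fun w => linForm (toVec (wordVec w))).prod

theorem mirrorProd_dvd {f : Poly} {d : ℕ} (hd : Odd d) (hf : f.IsHomogeneous d)
    (hinv : IsInvariant f) : mirrorProd ∣ f := by
  refine prod_dvd_of_pairwise (fun p hp => ?_) (fun p hp => ?_) ?_
  · obtain ⟨w, _, rfl⟩ := List.mem_map.1 hp
    exact (isMirror_wordVec w).prime
  · obtain ⟨w, _, rfl⟩ := List.mem_map.1 hp
    exact (isMirror_wordVec w).dvd hd hf hinv
  -- The divisibility to exclude is that of the earlier form by the later one, hence the swap of
  -- factors in the cross product.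
  · have h := pairwise_mirrorWords
    rw [List.pairwise_map] at h ⊢
    refine h.imp fun {v w} hvw => not_linForm_dvd fun h0 => hvw ?_
    simp only [crossTriple, Prod.mk_eq_zero, sub_eq_zero] at h0 ⊢
    exact ⟨by rw [mul_comm, ← h0.1, mul_comm], by rw [mul_comm, ← h0.2.1, mul_comm],
      by rw [mul_comm, ← h0.2.2, mul_comm]⟩

theorem isHomogeneous_mirrorProd : mirrorProd.IsHomogeneous 45 := by
  have h : ∀ l : List (List (Fin 4)),
      ((l.map fun w => linForm (toVec (wordVec w))).prod).IsHomogeneous l.length := fun l => by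
    induction l with
    | nil => exact isHomogeneous_one _ _
    | cons a l ih =>
      rw [List.map_cons, List.prod_cons, List.length_cons, add_comm]
      exact (isHomogeneous_linForm _).mul ih
  exact h mirrorWords

theorem mirrorProd_ne_zero : mirrorProd ≠ 0 := by
  refine List.prod_ne_zero fun h => ?_
  obtain ⟨w, _, hw⟩ := List.mem_map.1 h
  exact (isMirror_wordVec w).prime.ne_zero hw

/-- J has odd degree 45, so the mirror product divides it; the degrees agree, so the quotient is a
nonzero constant. -/
theorem dvd_of_odd {J : Poly} (hJ : J.IsHomogeneous 45) (hJinv : IsInvariant J) (h0 : J ≠ 0)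
    {f : Poly} {d : ℕ} (hd : Odd d) (hf : f.IsHomogeneous d) (hinv : IsInvariant f) : J ∣ f := by
  obtain ⟨q, rfl⟩ := mirrorProd_dvd (by decide) hJ hJinv
  have hq : q.IsHomogeneous 0 := isHomogeneous_of_mul isHomogeneous_mirrorProd mirrorProd_ne_zero hJ
  rw [← totalDegree_zero_iff_isHomogeneous, totalDegree_eq_zero_iff_eq_C] at hq
  have hc : coeff 0 q ≠ 0 := fun h => by
    rw [hq, h, C_0, mul_zero] at h0
    exact h0 rfl
  rw [hq]
  exact (IsUnit.mul_right_dvd ((isUnit_iff_ne_zero.2 hc).map C)).2 (mirrorProd_dvd hd hf hinv)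

/-! ### The forms of the theorem are basic invariants -/

theorem isBasic {F Φ Ψ : Poly} {a b c : ℂ} (ha : a ≠ 0) (hb : b ≠ 0) (hc : c ≠ 0)
    (hF : F = a • ∑ m : Fin 6, conic m ^ 3) (hΦ : Φ = b • (hessian F).det)
    (hΨ : Ψ = c • (borderedHessian F Φ).det) : IsBasic F Φ Ψ := by
  obtain ⟨k, hk, hsum⟩ := exists_sum_conic_cubes
  rw [hsum, smul_smul] at hF
  have homF : F.IsHomogeneous 6 := by
    rw [hF, smul_eq_C_mul]; exact isHomogeneous_sexticForm.C_mul _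
  have homΦ : Φ.IsHomogeneous 12 := by
    rw [hΦ, smul_eq_C_mul]; exact (isHomogeneous_det_hessian (n := 2) homF).C_mul _
  have homΨ : Ψ.IsHomogeneous 30 := by
    rw [hΨ, smul_eq_C_mul]; exact (isHomogeneous_det_borderedHessian (n := 5) homF homΦ).C_mul _
  have invF : IsInvariant F := by rw [hF]; exact isInvariant_sexticForm.smul _
  have invΦ : IsInvariant Φ := by rw [hΦ]; exact invF.det_hessian.smul _
  have invΨ : IsInvariant Ψ := by rw [hΨ]; exact (invF.det_borderedHessian invΦ).smul _
  -- The determinants are homogeneous in their arguments, so the normalizing constants and k come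
  -- out as a nonzero scalar factor.
  have hJ : jac F Φ Ψ ≠ 0 := by
    have h := jac_sexticForm_ne_zero
    rw [jac_eq_jacDet, det_borderedHessian_eq, det_hessian_eq] at h
    rw [hΨ, hΦ, jac_eq_jacDet, det_borderedHessian_eq, det_hessian_eq, hF]
    simp only [hessDet_smul, smul_smul, bordDet_smul, jacDet_smul]
    refine smul_ne_zero ?_ h
    simp only [ne_eq, mul_eq_zero, pow_eq_zero_iff, ha, hb, hc, hk, OfNat.ofNat_ne_zero,
      not_false_eq_true, or_self]
  exact ⟨homF, homΦ, homΨ, invF, invΦ, invΨ, hJ,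
    dvd_of_odd (isHomogeneous_jac homF homΦ homΨ) (invF.jac invΦ invΨ) hJ⟩

end Valentiner

theorem mainTheorem7 (F Φ Ψ : Valentiner.Poly) (a b c : ℂ) (ha : a ≠ 0) (hb : b ≠ 0) (hc : c ≠ 0)
    (hF : F = a • ∑ m : Fin 6, Valentiner.conic m ^ 3)
    (hΦ : Φ = b • (Valentiner.hessian F).det)
    (hΨ : Ψ = c • (Valentiner.borderedHessian F Φ).det) :
    (LinearIndependent ℂ (Valentiner.mon48 F Φ Ψ) ∧
      Submodule.span ℂ (Set.range (Valentiner.mon48 F Φ Ψ)) = Valentiner.invariants 48) ∧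
    (LinearIndependent ℂ (Valentiner.mon30 F Φ Ψ) ∧
      Submodule.span ℂ (Set.range (Valentiner.mon30 F Φ Ψ)) = Valentiner.invariants 30) ∧
    (LinearIndependent ℂ (Valentiner.mon24 F Φ) ∧
      Submodule.span ℂ (Set.range (Valentiner.mon24 F Φ)) = Valentiner.invariants 24) ∧
    (LinearIndependent ℂ (Valentiner.maps64 F Φ Ψ) ∧
      Submodule.span ℂ (Set.range (Valentiner.maps64 F Φ Ψ)) = Valentiner.equivariants 64) := by
  have h := Valentiner.isBasic ha hb hc hF hΦ hΨ
  refine ⟨⟨Valentiner.linearIndependent_mon48 h.jac_ne_zero, ?_⟩,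
    ⟨Valentiner.linearIndependent_mon30 h.jac_ne_zero, ?_⟩,
    ⟨Valentiner.linearIndependent_mon24 h.jac_ne_zero, ?_⟩,
    ⟨Valentiner.linearIndependent_maps64 h.jac_ne_zero, Valentiner.span_maps64 h⟩⟩
  · rw [← Valentiner.monomials_48, Valentiner.span_monomials_eq_invariants h (by decide)]
  · rw [← Valentiner.monomials_30, Valentiner.span_monomials_eq_invariants h (by decide)]
  · rw [← Valentiner.monomials_24 F Φ Ψ, Valentiner.span_monomials_eq_invariants h (by decide)]
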